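/- Let $b_\llcorner,b_\ast\in\mathbb R$ with $b_\llcorner-b_\ast\notin 2\pi\mathbb Z$. For a magnetic field $B:\mathbb Z^2\to\mathbb R$ let $$A_B(n,n-e_1)=\delta_{n_2>0}\sum_{m=1}^{n_2}B(n_1,m)-\delta_{n_2<0}\sum_{m=0}^{|n_2|-1}B(n_1,-m),\qquad A_B(n,n-e_2)=0,$$ let $\mathfrak s_{B,j}$ ($j=1,2$) be the magnetic translations $(\mathfrak s_{B,j}\psi)(n)=e^{\mathrm i A_B(n,n-e_j)}\psi(n-e_j)$ on $\ell^2(\mathbb Z^2)$, and let $\mathfrak A_B=C^*(\mathfrak s_{B,1},\mathfrak s_{B,2})\subset\mathcal B(\ell^2(\mathbb Z^2))$. Denote by - $\mathfrak A$ the algebra $\mathfrak A_B$ of the quarter-plane field $B(n)=b_\ast$ if $n_1\le 0$ or $n_2\le 0$, and $B(n)=b_\llcorner$ otherwise; - $\mathfrak A_{\mathtt U}$ the algebra of the field equal to $b_\ast$ for $n_1\le0$ and to $b_\llcorner$ for $n_1>0$; - $\mathfrak A_{\mathtt R}$ the algebra of the field equal to $b_\ast$ for $n_2\le 0$ and to $b_\llcorner$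 for $n_2>0$; - $\mathfrak A_{b_\llcorner}$, $\mathfrak A_{b_\ast}$ the algebras of the constant fields $b_\llcorner$ and $b_\ast$. An evaluation homomorphism is a surjective $*$-homomorphism that sends the $j$-th magnetic translation to the $j$-th magnetic translation for $j=1,2$ (to the pair of $j$-th magnetic translations, if the target is $\mathfrak A_{b_\llcorner}\oplus\mathfrak A_{b_\ast}$); it is unique if it exists. Then there are evaluation homomorphisms $\mathrm{ev}_{\mathtt U}:\mathfrak A\to\mathfrak A_{\mathtt U}$, $\mathrm{ev}_{\mathtt R}:\mathfrak A\to\mathfrak A_{\mathtt R}$, $\mathrm{ev}_{\mathtt U,b}:\mathfrak A_{\mathtt U}\to\mathfrak A_{b_\llcorner}\oplus\mathfrak A_{b_\ast}$ and $\mathrm{ev}_{\mathtt R,b}:\mathfrak A_{\mathtt R}\to\mathfrak A_{b_\llcorner}\oplus\mathfrak A_{b_\ast}$. With the pullback $$\mathfrak A_{\mathtt U,\mathtt R}=\{(\mathfrak u,\mathfrak r)\in\mathfrak A_{\mathtt U}\oplus\mathfrak A_{\mathtt R}\mid \mathrm{ev}_{\mathtt U,b}(\mathfrak u)=\mathrm{ev}_{\mathtt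 R,b}(\mathfrak r)\},$$ the formula $\gamma(\mathfrak a)=(\mathrm{ev}_{\mathtt U}(\mathfrak a),\mathrm{ev}_{\mathtt R}(\mathfrak a))$ defines a $*$-homomorphism $\gamma:\mathfrak A\to\mathfrak A_{\mathtt U,\mathtt R}$, the $C^*$-algebra $\mathcal K$ of compact operators on $\ell^2(\mathbb Z^2)$ is contained in $\mathfrak A$, and the sequence $$0\longrightarrow\mathcal K\overset{i}{\longrightarrow}\mathfrak A\overset{\gamma}{\longrightarrow}\mathfrak A_{\mathtt U,\mathtt R}\longrightarrow0,$$ where $i$ is the inclusion, is exact. Moreover, the projections $\mathfrak r_0$ and $\mathfrak u_0$ of $\ell^2(\mathbb Z^2)$ onto the functions supported in $\{(j,0)\mid j\ge0\}$ and in $\{(0,j)\mid j\ge0\}$, respectively, belong to $\mathfrak A$, and $\mathcal K=\mathfrak A(\mathfrak r_0)\cap\mathfrak A(\mathfrak u_0)$, where $\mathfrak A(\mathfrak x)$ is the closed two-sided ideal of $\mathfrak A$ generated by $\mathfrak x$. -/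

import Mathlib

open scoped ENNReal

namespace MagneticQuarterPlane

noncomputable section

/-- The lattice `ℤ²`. -/
abbrev Lattice : Type := ℤ × ℤ

/-- The Hilbert space `ℓ²(ℤ²)`. -/
abbrev L2 : Type := lp (fun _ : Lattice => ℂ) 2

/-- The `C*`-algebra of bounded operators on `ℓ²(ℤ²)`. -/
abbrev BoundedOp : Type := L2 →L[ℂ] L2

lemma two_toReal_pos : 0 < (2 : ℝ≥0∞).toReal := by norm_num

lemma memℓp_shift (v : Lattice) (ψ : L2) :
    Memℓp (fun n : Lattice => (ψ (n - v) : ℂ)) 2 := by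
  have h := (memℓp_gen_iff two_toReal_pos).1 ψ.2
  exact (memℓp_gen_iff two_toReal_pos).2 ((Equiv.subRight v).summable_iff.2 h)

/-- The (non-magnetic) translation by `v`: `(T_v ψ)(n) = ψ(n - v)`. -/
def translation (v : Lattice) : BoundedOp :=
  LinearMap.mkContinuous
    { toFun := fun ψ => ⟨fun n => ψ (n - v), memℓp_shift v ψ⟩
      map_add' := fun _ _ => rfl
      map_smul' := fun _ _ => rfl } 1 (by
    intro ψ
    rw [one_mul]
    refine lp.norm_le_of_tsum_le two_toReal_pos (norm_nonneg _) ?_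
    rw [lp.norm_rpow_eq_tsum two_toReal_pos]
    exact ((Equiv.subRight v).tsum_eq
      (fun n : Lattice => ‖(ψ n : ℂ)‖ ^ (2 : ℝ≥0∞).toReal)).le)

@[simp] lemma translation_apply (v : Lattice) (ψ : L2) (n : Lattice) :
    (translation v ψ) n = ψ (n - v) := rfl

lemma rpow_mul_le {g : Lattice → ℂ} {C : ℝ} (hC : ∀ n, ‖g n‖ ≤ C) (ψ : L2) (n : Lattice) :
    ‖g n * ψ n‖ ^ (2 : ℝ≥0∞).toReal
      ≤ C ^ (2 : ℝ≥0∞).toReal * ‖(ψ n : ℂ)‖ ^ (2 : ℝ≥0∞).toReal := by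
  have h0 : 0 ≤ C := (norm_nonneg _).trans (hC n)
  rw [norm_mul, ← Real.mul_rpow h0 (norm_nonneg _)]
  exact Real.rpow_le_rpow (by positivity)
    (mul_le_mul_of_nonneg_right (hC n) (norm_nonneg _)) two_toReal_pos.le

lemma memℓp_mul {g : Lattice → ℂ} {C : ℝ} (hC : ∀ n, ‖g n‖ ≤ C) (ψ : L2) :
    Memℓp (fun n : Lattice => g n * (ψ n : ℂ)) 2 := by
  have h := (memℓp_gen_iff two_toReal_pos).1 ψ.2
  exact (memℓp_gen_iff two_toReal_pos).2
    (Summable.of_nonneg_of_le (fun _ => by positivity) (rpow_mul_le hC ψ) (h.mul_left _))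

/-- The multiplication operator `(𝔪_g ψ)(n) = g(n) ψ(n)` of a bounded function `g`;
`C` is any bound of `g` and does not enter the values of the operator. -/
def mulOp (g : Lattice → ℂ) (C : ℝ) (hC : ∀ n, ‖g n‖ ≤ C) : BoundedOp :=
  LinearMap.mkContinuous
    { toFun := fun ψ => ⟨fun n => g n * ψ n, memℓp_mul hC ψ⟩
      map_add' := fun _ _ => by ext n; exact mul_add _ _ _
      map_smul' := fun _ _ => by ext n; exact mul_left_comm _ _ _ } C (by
    intro ψ
    have h0 : 0 ≤ C := (norm_nonneg _).trans (hC 0)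
    refine lp.norm_le_of_tsum_le two_toReal_pos (by positivity) ?_
    have h := (memℓp_gen_iff two_toReal_pos).1 ψ.2
    rw [Real.mul_rpow h0 (norm_nonneg _), lp.norm_rpow_eq_tsum two_toReal_pos, ← tsum_mul_left]
    exact Summable.tsum_le_tsum (rpow_mul_le hC ψ)
      (Summable.of_nonneg_of_le (fun _ => by positivity) (rpow_mul_le hC ψ) (h.mul_left _))
      (h.mul_left _))

@[simp] lemma mulOp_apply (g : Lattice → ℂ) (C : ℝ) (hC : ∀ n, ‖g n‖ ≤ C) (ψ : L2)
    (n : Lattice) : (mulOp g C hC ψ) n = g n * ψ n := rfl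

/-- The canonical basis `e₁ = (1,0)`, `e₂ = (0,1)` of `ℤ²`, indexed by `0, 1 : Fin 2`. -/
def basisVec (j : Fin 2) : Lattice := if j = 0 then (1, 0) else (0, 1)

/-- The standard vector potential `A_B(n, n - e_j)` of a magnetic field `B : ℤ² → ℝ`. It vanishes
in the direction `e₂`, and its circulation around the unit cells is `B`. -/
def vectorPotential (B : Lattice → ℝ) (n : Lattice) (j : Fin 2) : ℝ :=
  if j = 0 then
    (if 0 < n.2 then ∑ m ∈ Finset.Icc 1 n.2, B (n.1, m) else 0)
      - (if n.2 < 0 then ∑ m ∈ Finset.Icc 0 (|n.2| - 1), B (n.1, -m) else 0)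
  else 0

/-- The magnetic translation `(𝔰_j ψ)(n) = exp(i A_B(n, n - e_j)) ψ(n - e_j)`. -/
def magTranslation (B : Lattice → ℝ) (j : Fin 2) : BoundedOp :=
  mulOp (fun n => Complex.exp (Complex.I * (vectorPotential B n j : ℂ))) 1
      (fun _ => (Complex.norm_exp_I_mul_ofReal _).le)
    * translation (basisVec j)

/-- The magnetic algebra `C*(𝔰₁, 𝔰₂)` of the magnetic field `B`: the closure in operator norm
of the star subalgebra of bounded operators generated by the magnetic translations. -/
def magAlgebra (B : Lattice → ℝ) : StarSubalgebra ℂ BoundedOp :=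
  (StarAlgebra.adjoin ℂ (Set.range (magTranslation B))).topologicalClosure

lemma magTranslation_mem (B : Lattice → ℝ) (j : Fin 2) :
    magTranslation B j ∈ magAlgebra B :=
  StarSubalgebra.le_topologicalClosure _ (StarAlgebra.subset_adjoin ℂ _ ⟨j, rfl⟩)

/-- The magnetic translations as elements of the magnetic algebra. -/
def gen (B : Lattice → ℝ) (j : Fin 2) : magAlgebra B :=
  ⟨magTranslation B j, magTranslation_mem B j⟩

/-- The quarter-plane magnetic field: `bstar` where `n₁ ≤ 0` or `n₂ ≤ 0`, and `bcor` on the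
open quarter-plane. -/
def quarterField (bcor bstar : ℝ) (n : Lattice) : ℝ :=
  if n.1 ≤ 0 ∨ n.2 ≤ 0 then bstar else bcor

/-- The Iwatsuka field seen far up (`n₂ → +∞`) in the quarter-plane system. -/
def upField (bcor bstar : ℝ) (n : Lattice) : ℝ := if n.1 ≤ 0 then bstar else bcor

/-- The Iwatsuka field seen far to the right (`n₁ → +∞`) in the quarter-plane system. -/
def rightField (bcor bstar : ℝ) (n : Lattice) : ℝ := if n.2 ≤ 0 then bstar else bcor

/-- The constant magnetic field. -/
def constField (b : ℝ) (_ : Lattice) : ℝ := b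

/-- The magnetic quarter-plane algebra `𝔄`. -/
abbrev quarterAlgebra (bcor bstar : ℝ) : StarSubalgebra ℂ BoundedOp :=
  magAlgebra (quarterField bcor bstar)

/-- The Iwatsuka algebra `𝔄_U`. -/
abbrev upAlgebra (bcor bstar : ℝ) : StarSubalgebra ℂ BoundedOp :=
  magAlgebra (upField bcor bstar)

/-- The Iwatsuka algebra `𝔄_R`. -/
abbrev rightAlgebra (bcor bstar : ℝ) : StarSubalgebra ℂ BoundedOp :=
  magAlgebra (rightField bcor bstar)

/-- The bulk algebra, the direct sum of the magnetic algebras of the two constant fields. -/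
abbrev BulkAlgebra (bcor bstar : ℝ) : Type :=
  magAlgebra (constField bcor) × magAlgebra (constField bstar)

/-- An evaluation homomorphism between magnetic algebras: a surjective `*`-homomorphism which
sends the magnetic translations to the magnetic translations. -/
def IsEvaluation {B B' : Lattice → ℝ} (ev : magAlgebra B →⋆ₐ[ℂ] magAlgebra B') : Prop :=
  Function.Surjective ev ∧ ∀ j, ev (gen B j) = gen B' j

/-- An evaluation homomorphism onto the bulk algebra. -/
def IsBulkEvaluation {B : Lattice → ℝ} {bcor bstar : ℝ}
    (ev : magAlgebra B →⋆ₐ[ℂ] BulkAlgebra bcor bstar) : Prop :=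
  Function.Surjective ev ∧ ∀ j, ev (gen B j) = (gen (constField bcor) j, gen (constField bstar) j)

/-- The asymptotic algebra: the pullback `{(u, r) ∈ 𝔄_U ⊕ 𝔄_R | ev_{U,b}(u) = ev_{R,b}(r)}` of
two `*`-homomorphisms into the bulk algebra. -/
def asymptoticAlgebra {bcor bstar : ℝ}
    (evUb : upAlgebra bcor bstar →⋆ₐ[ℂ] BulkAlgebra bcor bstar)
    (evRb : rightAlgebra bcor bstar →⋆ₐ[ℂ] BulkAlgebra bcor bstar) :
    StarSubalgebra ℂ (upAlgebra bcor bstar × rightAlgebra bcor bstar) :=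
  StarAlgHom.equalizer
    (evUb.comp (StarAlgHom.fst ℂ (upAlgebra bcor bstar) (rightAlgebra bcor bstar)))
    (evRb.comp (StarAlgHom.snd ℂ (upAlgebra bcor bstar) (rightAlgebra bcor bstar)))

lemma norm_indicator_one_le (S : Set Lattice) (n : Lattice) :
    ‖S.indicator (fun _ => (1 : ℂ)) n‖ ≤ 1 := by
  by_cases h : n ∈ S <;> simp [h]

/-- The projection `𝔪_{χ_S}` onto the functions supported in `S ⊆ ℤ²`. -/
def siteProj (S : Set Lattice) : BoundedOp :=
  mulOp (S.indicator fun _ => 1) 1 (norm_indicator_one_le S)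

/-- `𝔯₀`, the projection onto the right half-line `{j e₁ | j ∈ ℕ}`. -/
def rightProj : BoundedOp := siteProj (Set.range fun j : ℕ => ((j : ℤ), (0 : ℤ)))

/-- `𝔲₀`, the projection onto the up half-line `{j e₂ | j ∈ ℕ}`. -/
def upProj : BoundedOp := siteProj (Set.range fun j : ℕ => ((0 : ℤ), (j : ℤ)))

/-- The closed two-sided ideal generated by `x`. -/
def closedIdeal {A : Type*} [Ring A] [TopologicalSpace A] (x : A) : Set A :=
  closure (TwoSidedIdeal.span {x} : Set A)

lemma isCompactOperator_star {T : BoundedOp} (hT : IsCompactOperator T) :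
    IsCompactOperator (star T : BoundedOp) := by
  have hS : IsCompactOperator (T * star T : BoundedOp) := hT.comp_clm (star T)
  have hc := hS.isCompact_closure_image_ball (f := (T * star T : BoundedOp).toLinearMap) 1
  have htb : TotallyBounded ((T * star T : BoundedOp) '' Metric.ball 0 1) :=
    hc.totallyBounded.subset subset_closure
  refine (isCompactOperator_iff_isCompact_closure_image_ball
    (star T : BoundedOp).toLinearMap one_pos).2 ?_
  refine TotallyBounded.isCompact_of_isClosed (TotallyBounded.closure ?_) isClosed_closure
  rw [Metric.totallyBounded_iff]
  intro ε hε
  obtain ⟨t, hts, htf, hcov⟩ := totallyBounded_iff_subset.1 htb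
    {p | dist p.1 p.2 < ε ^ 2 / 2} (Metric.dist_mem_uniformity (by positivity))
  have hts' : ∀ y ∈ t, ∃ x : L2, x ∈ Metric.ball (0 : L2) 1 ∧ (T * star T : BoundedOp) x = y :=
    fun y hy => hts hy
  choose! f hf hfe using hts'
  refine ⟨(fun y => (star T : BoundedOp) (f y)) '' t, htf.image _, ?_⟩
  rintro _ ⟨x, hx, rfl⟩
  have hx1 := hcov ⟨x, hx, rfl⟩
  simp only [Set.mem_iUnion, Set.mem_ofPred_eq] at hx1
  obtain ⟨y, hy, hxy⟩ := hx1
  simp only [Set.mem_iUnion]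
  refine ⟨_, ⟨y, hy, rfl⟩, ?_⟩
  have hyb := hf y hy
  have hye := hfe y hy
  rw [Metric.mem_ball, dist_eq_norm]
  change ‖(star T : BoundedOp) x - (star T : BoundedOp) (f y)‖ < ε
  rw [← map_sub]
  have h1 : ‖(star T : BoundedOp) (x - f y)‖ ^ 2
      ≤ ‖(T * star T : BoundedOp) (x - f y)‖ * ‖x - f y‖ := by
    have h := ContinuousLinearMap.apply_norm_sq_eq_inner_adjoint_left
      (𝕜 := ℂ) (star T : BoundedOp) (x - f y)
    rw [h]
    have e : ((ContinuousLinearMap.adjoint (star T : BoundedOp)) ∘L (star T : BoundedOp))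
        = (T * star T : BoundedOp) := by
      rw [← ContinuousLinearMap.star_eq_adjoint, star_star]; rfl
    rw [e]
    exact (RCLike.re_le_norm _).trans (norm_inner_le_norm _ _)
  have h2 : ‖(T * star T : BoundedOp) (x - f y)‖ < ε ^ 2 / 2 := by
    rw [map_sub, hye, ← dist_eq_norm]; exact hxy
  have h3 : ‖x - f y‖ < 2 := by
    rw [mem_ball_zero_iff] at hx hyb
    linarith [norm_sub_le x (f y)]
  have h4 : ‖(star T : BoundedOp) (x - f y)‖ ^ 2 < ε ^ 2 := by
    nlinarith [norm_nonneg ((T * star T : BoundedOp) (x - f y)), norm_nonneg (x - f y)]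
  exact lt_of_pow_lt_pow_left₀ 2 hε.le h4

/-- The `C*`-algebra `𝒦` of compact operators on `ℓ²(ℤ²)`. -/
def compactOps : NonUnitalStarSubalgebra ℂ BoundedOp where
  carrier := {T | IsCompactOperator T}
  add_mem' hS hT := IsCompactOperator.add hS hT
  zero_mem' := isCompactOperator_zero
  mul_mem' {S T} hS _ := IsCompactOperator.comp_clm (f := S) hS T
  smul_mem' c _ hT := IsCompactOperator.smul hT c
  star_mem' hT := isCompactOperator_star hT

end

end MagneticQuarterPlane

open MagneticQuarterPlane

open scoped ENNReal

/-! An evaluation homomorphism records what an operator looks like far out in a half-plane. In a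
half-plane region `W` where the potentials of `B` and `B'` coincide, call `(x, y)` an asymptotic
pair if `(x - y) * siteProj (W N)` tends to zero in norm and `y` hardly leaves `W`. Such pairs form
a closed algebra (`asymptoticPairs`) containing the pairs of generators and of their adjoints. If
the field `B'` is invariant in the direction of the half-plane, an element of its algebra is
determined by its behaviour along `W` (`eq_zero_of_vanishesAlong`), so the relation is the graph of
a `*`-homomorphism (`exists_evaluation`) whose kernel consists of the elements vanishing along `W`.

The flux operator built from the two translations multiplies by `exp(i B(n))`. As the two fluxes
differ, the indicator of the set where the field is `bcor` lies in the algebra. In the Iwatsuka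
algebras it is sent to `(1, 0)`, so the two bulk limits are jointly surjective; in the quarter-plane
algebra its translates produce half-strips, half-lines and the projection onto the origin, and with
the latter all compact operators.

An element killed by both evaluations vanishes along all four half-planes, the lower and left ones
through the bulk limit `bstar`. It is then a norm limit of its restrictions to finite boxes, hence
compact; conversely compact operators vanish along every region. For surjectivity of `γ` it suffices
to lift `(0, r)` with `r` in the kernel of the bulk evaluation: `r` is the limit of its cut-offs to
horizontal strips, strip projections lift to half-strips killed by `evU`, and the range of a
`*`-homomorphism is closed (`exists_lift_of_bulk_eq_zero`). Finally, `evU` kills `rightProj` and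
`evR` kills `upProj`, while both projections dominate the projection onto the origin. -/

namespace MagneticQuarterPlane

open Filter Topology

/-! ### Topological generators and closed ideals. -/

section Generators

variable {X Y : Type*} [Ring X] [StarRing X] [Algebra ℂ X] [StarModule ℂ X] [TopologicalSpace X]
  [IsTopologicalRing X] [ContinuousStar X] [Ring Y] [StarRing Y] [Algebra ℂ Y]
  [TopologicalSpace Y] [T2Space Y]

/-- A closed subalgebra which contains the generators and their adjoints is everything. -/
lemma mem_of_generators {ι : Type*} {x : ι → X}
    (hx : (StarAlgebra.adjoin ℂ (Set.range x)).topologicalClosure = ⊤)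
    (S : Subalgebra ℂ X) (hS : IsClosed (S : Set X)) (h : ∀ j, x j ∈ S) (h' : ∀ j, star (x j) ∈ S)
    (a : X) : a ∈ S := by
  -- `S` need not be stable under the adjoint: the star algebra generated by a set is the plain
  -- algebra generated by the set and its adjoints. This matters because the asymptotic conditions
  -- used later are one-sided.
  have h1 : (StarAlgebra.adjoin ℂ (Set.range x)).toSubalgebra ≤ S := by
    rw [StarAlgebra.adjoin_toSubalgebra]
    refine Algebra.adjoin_le ?_
    rintro y (⟨j, rfl⟩ | hy)
    · exact h j
    · obtain ⟨j, hj⟩ := Set.mem_star.1 hy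
      have := h' j
      rwa [hj, star_star] at this
  have h2 : a ∈ (StarAlgebra.adjoin ℂ (Set.range x)).topologicalClosure := by rw [hx]; trivial
  exact closure_minimal (show ((StarAlgebra.adjoin ℂ (Set.range x) : Set X)) ⊆ S from h1) hS h2

lemma starAlgHom_eq_of_generators {ι : Type*} {x : ι → X}
    (hx : (StarAlgebra.adjoin ℂ (Set.range x)).topologicalClosure = ⊤)
    {φ ψ : X →⋆ₐ[ℂ] Y} (hφ : Continuous φ) (hψ : Continuous ψ) (h : ∀ j, φ (x j) = ψ (x j)) :
    φ = ψ := by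
  ext a
  refine mem_of_generators hx (AlgHom.equalizer φ.toAlgHom ψ.toAlgHom)
    (isClosed_eq hφ hψ) h (fun j => ?_) a
  change φ (star (x j)) = ψ (star (x j))
  rw [map_star, map_star, h]

end Generators

/-- A `*`-homomorphism which kills `x` kills the closed ideal generated by `x`. -/
lemma map_eq_zero_of_mem_closedIdeal {X Y : Type*} [Ring X] [Star X]
    [Algebra ℂ X] [TopologicalSpace X] [Ring Y] [Star Y] [Algebra ℂ Y] [TopologicalSpace Y]
    [T2Space Y] {φ : X →⋆ₐ[ℂ] Y} (hφ : Continuous φ) {x a : X} (hx : φ x = 0) (ha : a ∈ closedIdeal x) :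
    φ a = 0 := by
  refine closure_minimal (t := {a | φ a = 0}) ?_
    (isClosed_eq hφ continuous_const) ha
  have : TwoSidedIdeal.span {x} ≤ TwoSidedIdeal.ker φ :=
    TwoSidedIdeal.span_le.2 (by rintro _ rfl; exact (TwoSidedIdeal.mem_ker φ).2 hx)
  exact fun b hb => (TwoSidedIdeal.mem_ker φ).1 (this hb)

/-- The element `x` acts as a cut-off gluing separate preimages `z` and `w` into `x * z + (1 - x) *
w`. -/
lemma prod_surjective_of_unit {X Y Z : Type*} [Ring X] [Star X] [Algebra ℂ X]
    [Ring Y] [Star Y] [Algebra ℂ Y] [Ring Z] [Star Z] [Algebra ℂ Z]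
    {φ : X →⋆ₐ[ℂ] Y} {ψ : X →⋆ₐ[ℂ] Z} (hφ : Function.Surjective φ) (hψ : Function.Surjective ψ)
    {x : X} (h1 : φ x = 1) (h2 : ψ x = 0) : Function.Surjective (φ.prod ψ) := by
  rintro ⟨a, b⟩
  obtain ⟨z, rfl⟩ := hφ a
  obtain ⟨w, rfl⟩ := hψ b
  exact ⟨x * z + (1 - x) * w, Prod.ext (by simp [h1]) (by simp [h2])⟩

/-! ### Closed ranges, and homomorphisms defined by their graphs. -/

section CStar

variable {X Y : Type*} [CStarAlgebra X] [CStarAlgebra Y]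

lemma continuous_starAlgHom (φ : X →⋆ₐ[ℂ] Y) : Continuous φ :=
  AddMonoidHomClass.continuous_of_bound φ 1 fun a => by
    simpa using NonUnitalStarAlgHom.norm_apply_le φ a

/-- A self-adjoint element of the range of a `*`-homomorphism lifts without increasing the norm. -/
lemma exists_selfAdjoint_lift (φ : X →⋆ₐ[ℂ] Y) {a : X} (ha : IsSelfAdjoint a) :
    ∃ a' : X, φ a' = φ a ∧ ‖a'‖ ≤ ‖φ a‖ := by
  set r : ℝ := ‖φ a‖ with hr
  have hr0 : 0 ≤ r := norm_nonneg _
  -- Truncation to `[-r, r]`: it is the identity on the spectrum of `φ a`, and the functional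
  -- calculus commutes with `φ`, so truncating `a` does not change its image.
  let f : ℝ → ℝ := fun t => max (-r) (min r t)
  have hf : Continuous f := by fun_prop
  have hφ : Continuous φ := continuous_starAlgHom φ
  have hφa : IsSelfAdjoint (φ a) := ha.map φ
  refine ⟨cfc f a, ?_, ?_⟩
  · rw [StarAlgHom.map_cfc φ f a hf.continuousOn hφ ha hφa]
    conv_rhs => rw [← cfc_id ℝ (φ a) hφa]
    refine cfc_congr fun t ht => ?_
    have h1 : ‖t‖ ≤ r := by
      rcases subsingleton_or_nontrivial Y with h | h
      · simp at ht
      · exact spectrum.norm_le_norm_of_mem ht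
    rw [Real.norm_eq_abs, abs_le] at h1
    simp [f, h1.1, h1.2]
  · refine norm_cfc_le hr0 fun t _ => ?_
    rw [Real.norm_eq_abs, abs_le]
    exact ⟨le_max_left _ _, max_le (by linarith) (min_le_left _ _)⟩

/-- The real and imaginary parts are lifted separately, each with norm at most `‖φ a‖`; hence the
factor 2, whose value is immaterial. -/
lemma exists_lift_norm_le (φ : X →⋆ₐ[ℂ] Y) (a : X) :
    ∃ a' : X, φ a' = φ a ∧ ‖a'‖ ≤ 2 * ‖φ a‖ := by
  obtain ⟨x, hx, hxn⟩ := exists_selfAdjoint_lift φ (realPart a).2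
  obtain ⟨y, hy, hyn⟩ := exists_selfAdjoint_lift φ (imaginaryPart a).2
  have hs : ∀ (r : ℝ) (b : X), φ (r • b) = r • φ b := fun r b => by
    rw [← Complex.coe_smul, map_smul, Complex.coe_smul]
  have hre : ‖φ (realPart a : X)‖ ≤ ‖φ a‖ := by
    have : φ (realPart a : X) = (realPart (φ a) : Y) := by
      simp [realPart_apply_coe, hs, map_star]
    rw [this]; exact realPart.norm_le (φ a)
  have him : ‖φ (imaginaryPart a : X)‖ ≤ ‖φ a‖ := by
    have : φ (imaginaryPart a : X) = (imaginaryPart (φ a) : Y) := by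
      simp [imaginaryPart_apply_coe, hs, map_star]
    rw [this]; exact imaginaryPart.norm_le (φ a)
  refine ⟨x + Complex.I • y, ?_, ?_⟩
  · rw [map_add, map_smul, hx, hy, ← map_smul, ← map_add, realPart_add_I_smul_imaginaryPart]
  · calc ‖x + Complex.I • y‖ ≤ ‖x‖ + ‖y‖ := by
          refine (norm_add_le _ _).trans_eq ?_
          rw [norm_smul, Complex.norm_I, one_mul]
      _ ≤ _ := by linarith

/-- The range of a `*`-homomorphism between `C*`-algebras is closed. -/
lemma isClosed_range_starAlgHom (φ : X →⋆ₐ[ℂ] Y) : IsClosed (Set.range φ) := by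
  let f : NormedAddGroupHom X Y :=
    { toFun := φ
      map_add' := map_add φ
      bound' := ⟨1, fun v => by simpa using NonUnitalStarAlgHom.norm_apply_le φ v⟩ }
  have hs : f.SurjectiveOnWith f.range 2 := by
    rintro _ ⟨a, rfl⟩
    exact exists_lift_norm_le φ a
  -- Norm-controlled lifts turn an approximation of a limit point into a convergent series of
  -- preimages.
  have h := controlled_closure_of_complete two_pos one_pos hs
  refine isClosed_of_closure_subset fun y hy => ?_
  obtain ⟨x, hx, -⟩ := h y hy
  exact ⟨x, hx⟩

/-- A `*`-homomorphism onto a set of topological generators is surjective. -/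
lemma surjective_of_generators {ι : Type*} (φ : X →⋆ₐ[ℂ] Y) (y : ι → Y)
    (hy : (StarAlgebra.adjoin ℂ (Set.range y)).topologicalClosure = ⊤)
    (h : ∀ j, y j ∈ Set.range φ) : Function.Surjective φ := by
  have h1 : StarAlgebra.adjoin ℂ (Set.range y) ≤ φ.range :=
    StarAlgebra.adjoin_le (by rintro _ ⟨j, rfl⟩; exact h j)
  have h2 : (StarAlgebra.adjoin ℂ (Set.range y)).topologicalClosure ≤ φ.range :=
    StarSubalgebra.topologicalClosure_minimal h1 (isClosed_range_starAlgHom φ)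
  intro z
  have : z ∈ (⊤ : StarSubalgebra ℂ Y) := trivial
  rw [← hy] at this
  exact h2 this

/-- The closed star algebra `T` generated by the pairs lies in `R`, so by `h0` its first projection
is injective; it is surjective because its range is closed and contains the generators. Thus `T` is
the graph of the desired map. -/
lemma exists_starAlgHom_of_relation {ι : Type*} {x : ι → X} {y : ι → Y}
    (hx : (StarAlgebra.adjoin ℂ (Set.range x)).topologicalClosure = ⊤)
    (R : Subalgebra ℂ (X × Y)) (hR : IsClosed (R : Set (X × Y)))
    (h : ∀ j, (x j, y j) ∈ R) (h' : ∀ j, (star (x j), star (y j)) ∈ R)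
    (h0 : ∀ b, ((0 : X), b) ∈ R → b = 0) :
    ∃ φ : X →⋆ₐ[ℂ] Y, ∀ j, φ (x j) = y j := by
  let T : StarSubalgebra ℂ (X × Y) :=
    (StarAlgebra.adjoin ℂ (Set.range fun j => (x j, y j))).topologicalClosure
  have hT : IsClosed (T : Set (X × Y)) := StarSubalgebra.isClosed_topologicalClosure _
  have hg : ∀ j, (x j, y j) ∈ T := fun j =>
    StarSubalgebra.le_topologicalClosure _ (StarAlgebra.subset_adjoin ℂ _ ⟨j, rfl⟩)
  have hTR : ∀ z ∈ T, z ∈ R := by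
    have h1 : (StarAlgebra.adjoin ℂ (Set.range fun j => (x j, y j))).toSubalgebra ≤ R := by
      rw [StarAlgebra.adjoin_toSubalgebra]
      refine Algebra.adjoin_le ?_
      rintro z (⟨j, rfl⟩ | hz)
      · exact h j
      · obtain ⟨j, hj⟩ := Set.mem_star.1 hz
        have := h' j
        rwa [show (star (x j), star (y j)) = star (x j, y j) from rfl,
          show (x j, y j) = star z from hj, star_star] at this
    exact fun z hz => closure_minimal
      (show (StarAlgebra.adjoin ℂ (Set.range fun j => (x j, y j)) : Set (X × Y)) ⊆ R from h1)
      hR hz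
  let p : T →⋆ₐ[ℂ] X := (StarAlgHom.fst ℂ X Y).comp T.subtype
  let q : T →⋆ₐ[ℂ] Y := (StarAlgHom.snd ℂ X Y).comp T.subtype
  have hpi : Function.Injective p := by
    refine (injective_iff_map_eq_zero p).2 ?_
    rintro ⟨⟨a, b⟩, hab⟩ (ha : a = 0)
    subst ha
    have := h0 b (hTR _ hab)
    subst this
    rfl
  have hps : Function.Surjective p :=
    surjective_of_generators p x hx fun j => ⟨⟨_, hg j⟩, rfl⟩
  let e := StarAlgEquiv.ofBijective p ⟨hpi, hps⟩
  refine ⟨q.comp (e.symm : X →⋆ₐ[ℂ] T), fun j => ?_⟩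
  have : e.symm (x j) = ⟨_, hg j⟩ := by
    rw [StarAlgEquiv.symm_apply_eq]; rfl
  change q (e.symm (x j)) = y j
  rw [this]
  rfl

end CStar

/-! ### Magnetic algebras, adjoints, and the action of the magnetic translations. -/

lemma isClosed_magAlgebra (B : Lattice → ℝ) : IsClosed (magAlgebra B : Set BoundedOp) :=
  StarSubalgebra.isClosed_topologicalClosure _

lemma gen_generates (B : Lattice → ℝ) :
    (StarAlgebra.adjoin ℂ (Set.range (gen B))).topologicalClosure = ⊤ := by
  set S := (StarAlgebra.adjoin ℂ (Set.range (gen B))).topologicalClosure with hS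
  have hSc : IsClosed (S : Set (magAlgebra B)) := StarSubalgebra.isClosed_topologicalClosure _
  have hcl : IsClosed
      ((S.map (magAlgebra B).subtype : StarSubalgebra ℂ BoundedOp) : Set BoundedOp) :=
    (isClosed_magAlgebra B).isClosedEmbedding_subtypeVal.isClosedMap _ hSc
  have h : magAlgebra B ≤ S.map (magAlgebra B).subtype := by
    refine StarSubalgebra.topologicalClosure_minimal (StarAlgebra.adjoin_le ?_) hcl
    rintro _ ⟨j, rfl⟩
    exact ⟨gen B j, StarSubalgebra.le_topologicalClosure _
      (StarAlgebra.subset_adjoin ℂ _ ⟨j, rfl⟩), rfl⟩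
  refine eq_top_iff.2 fun a _ => ?_
  obtain ⟨b, hb, hba⟩ := h a.2
  rwa [show b = a from Subtype.ext hba] at hb

lemma continuous_magAlgebra_hom {B B' : Lattice → ℝ} (φ : magAlgebra B →⋆ₐ[ℂ] magAlgebra B') :
    Continuous φ := by
  -- Closedness is what makes the subalgebras `C*`-algebras for instance search.
  have := isClosed_magAlgebra B
  have := isClosed_magAlgebra B'
  exact continuous_starAlgHom φ

lemma boundedOp_ext {S T : BoundedOp} (h : ∀ ψ n, (S ψ) n = (T ψ) n) : S = T :=
  ContinuousLinearMap.ext fun ψ => lp.ext (funext fun n => h ψ n)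

@[simp] lemma sub_apply_apply (S T : BoundedOp) (ψ : L2) (n : Lattice) :
    ((S - T) ψ) n = (S ψ) n - (T ψ) n := rfl

@[simp] lemma smul_apply_apply (c : ℂ) (T : BoundedOp) (ψ : L2) (n : Lattice) :
    ((c • T) ψ) n = c * (T ψ) n := rfl

@[simp] lemma one_apply_apply (ψ : L2) (n : Lattice) : ((1 : BoundedOp) ψ) n = ψ n := rfl

@[simp] lemma mul_apply_eq (S T : BoundedOp) (ψ : L2) : (S * T) ψ = S (T ψ) := rfl

@[simp] lemma zero_apply_apply (ψ : L2) (n : Lattice) : ((0 : BoundedOp) ψ) n = 0 := rfl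

lemma star_eq_of_inner {S T : BoundedOp} (h : ∀ x y : L2, inner ℂ (S x) y = inner ℂ x (T y)) :
    star S = T := by
  rw [ContinuousLinearMap.star_eq_adjoint, eq_comm, ContinuousLinearMap.eq_adjoint_iff]
  intro x y
  rw [← inner_conj_symm, ← h, inner_conj_symm]

lemma star_translation (v : Lattice) : star (translation v) = translation (-v) := by
  refine star_eq_of_inner fun x y => ?_
  rw [lp.inner_eq_tsum, lp.inner_eq_tsum,
    ← (Equiv.subRight v).tsum_eq fun i => inner ℂ (x i) ((translation (-v) y) i)]
  refine tsum_congr fun n => ?_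
  simp

lemma star_mulOp (g : Lattice → ℂ) (C : ℝ) (hC : ∀ n, ‖g n‖ ≤ C) :
    star (mulOp g C hC)
      = mulOp (fun n => star (g n)) C (fun n => by rw [norm_star]; exact hC n) := by
  refine star_eq_of_inner fun x y => ?_
  rw [lp.inner_eq_tsum, lp.inner_eq_tsum]
  refine tsum_congr fun n => ?_
  simp only [mulOp_apply, RCLike.inner_apply, map_mul, RCLike.star_def]
  ring

lemma norm_mulOp_le (g : Lattice → ℂ) (C : ℝ) (hC : ∀ n, ‖g n‖ ≤ C) : ‖mulOp g C hC‖ ≤ C :=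
  LinearMap.mkContinuous_norm_le _ ((norm_nonneg _).trans (hC 0)) _

/-- The phase `exp(i A_B(n, n - e_j))` of the magnetic translation. -/
noncomputable def phase (B : Lattice → ℝ) (j : Fin 2) (n : Lattice) : ℂ :=
  Complex.exp (Complex.I * (vectorPotential B n j : ℂ))

lemma star_phase_mul_phase (B : Lattice → ℝ) (j : Fin 2) (n : Lattice) :
    star (phase B j n) * phase B j n = 1 := by
  rw [RCLike.star_def, ← Complex.normSq_eq_conj_mul_self, Complex.normSq_eq_norm_sq, phase,
    Complex.norm_exp_I_mul_ofReal]
  simp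

lemma phase_ne_zero (B : Lattice → ℝ) (j : Fin 2) (n : Lattice) : phase B j n ≠ 0 :=
  Complex.exp_ne_zero _

@[simp] lemma phase_one (B : Lattice → ℝ) (n : Lattice) : phase B 1 n = 1 := by
  simp [phase, vectorPotential]

@[simp] lemma magTranslation_apply (B : Lattice → ℝ) (j : Fin 2) (ψ : L2) (n : Lattice) :
    (magTranslation B j ψ) n = phase B j n * ψ (n - basisVec j) := rfl

@[simp] lemma star_magTranslation_apply (B : Lattice → ℝ) (j : Fin 2) (ψ : L2) (n : Lattice) :
    ((star (magTranslation B j) : BoundedOp) ψ) n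
      = star (phase B j (n + basisVec j)) * ψ (n + basisVec j) := by
  rw [magTranslation, star_mul, star_mulOp, star_translation]
  simp only [mul_apply_eq, translation_apply, mulOp_apply, sub_neg_eq_add]
  rfl

lemma star_magTranslation_mul_self (B : Lattice → ℝ) (j : Fin 2) :
    star (magTranslation B j) * magTranslation B j = 1 := by
  refine boundedOp_ext fun ψ n => ?_
  simp only [mul_apply_eq, star_magTranslation_apply, magTranslation_apply, add_sub_cancel_right,
    one_apply_apply]
  rw [← mul_assoc, star_phase_mul_phase, one_mul]

lemma magTranslation_mul_star_self (B : Lattice → ℝ) (j : Fin 2) :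
    magTranslation B j * star (magTranslation B j) = 1 := by
  refine boundedOp_ext fun ψ n => ?_
  simp only [mul_apply_eq, star_magTranslation_apply, magTranslation_apply, sub_add_cancel,
    one_apply_apply]
  rw [← mul_assoc, mul_comm (phase B j n), star_phase_mul_phase, one_mul]

lemma commute_star_magTranslation {B : Lattice → ℝ} {j : Fin 2} {V : BoundedOp}
    (h : Commute V (magTranslation B j)) : Commute V (star (magTranslation B j)) := by
  set s := magTranslation B j
  have h1 : star s * s = 1 := star_magTranslation_mul_self B j
  have h2 : s * star s = 1 := magTranslation_mul_star_self B j
  calc V * star s = star s * (s * V) * star s := by rw [← mul_assoc, h1, one_mul]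
    _ = star s * V * (s * star s) := by rw [← h.eq]; simp only [mul_assoc]
    _ = star s * V := by rw [h2, mul_one]

/-! ### The vector potential -/

lemma vectorPotential_one (B : Lattice → ℝ) (n : Lattice) : vectorPotential B n 1 = 0 := by
  simp [vectorPotential]

/-- The circulation around a unit cell reduces to this difference since the potential vanishes along
`e₂`. Starting the negative sum at `m = 0` makes the identity hold across `b = 0`. -/
lemma vectorPotential_sub (B : Lattice → ℝ) (a b : ℤ) :
    vectorPotential B (a, b) 0 - vectorPotential B (a, b - 1) 0 = B (a, b) := by
  simp only [vectorPotential, if_true]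
  rcases lt_trichotomy b 0 with h | h | h
  · have e : Finset.Icc 0 (|b - 1| - 1) = insert (-b) (Finset.Icc 0 (|b| - 1)) := by
      rw [abs_of_neg h, abs_of_neg (by lia : b - 1 < 0)]
      ext m; simp only [Finset.mem_Icc, Finset.mem_insert]; lia
    have hn : (-b) ∉ Finset.Icc 0 (|b| - 1) := by
      rw [abs_of_neg h, Finset.mem_Icc]; lia
    rw [if_neg (by lia), if_pos h, if_neg (by lia), if_pos (by lia), e, Finset.sum_insert hn]
    simp
  · subst h; simp
  · have e : Finset.Icc 1 b = insert b (Finset.Icc 1 (b - 1)) := by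
      ext m; simp only [Finset.mem_Icc, Finset.mem_insert]; lia
    have hn : b ∉ Finset.Icc 1 (b - 1) := by rw [Finset.mem_Icc]; lia
    rw [if_pos h, if_neg (by lia), if_neg (by lia : ¬ b - 1 < 0), e, Finset.sum_insert hn]
    split_ifs with h'
    · ring
    · rw [Finset.Icc_eq_empty (by lia)]; simp

/-- At heights `n₂ ≥ 0` the potential only sees the field at heights `m ≥ 1`, and at `n₂ ≤ 0` only
at heights `m ≤ 0`. Hence potentials agree exactly on half-planes, with no change of gauge. -/
lemma vectorPotential_congr_of_nonneg {B B' : Lattice → ℝ} {n : Lattice} (hn : 0 ≤ n.2)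
    (h : ∀ m, 1 ≤ m → B (n.1, m) = B' (n.1, m)) (j : Fin 2) :
    vectorPotential B n j = vectorPotential B' n j := by
  simp only [vectorPotential, if_neg (not_lt.2 hn)]
  rw [Finset.sum_congr rfl fun m hm => h m (Finset.mem_Icc.1 hm).1]

lemma vectorPotential_congr_of_nonpos {B B' : Lattice → ℝ} {n : Lattice} (hn : n.2 ≤ 0)
    (h : ∀ m, m ≤ 0 → B (n.1, m) = B' (n.1, m)) (j : Fin 2) :
    vectorPotential B n j = vectorPotential B' n j := by
  simp only [vectorPotential, if_neg (not_lt.2 hn)]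
  rw [Finset.sum_congr rfl fun m hm => h (-m) (by have := (Finset.mem_Icc.1 hm).1; lia)]

lemma vectorPotential_congr {B B' : Lattice → ℝ} {n : Lattice}
    (h : ∀ m, B (n.1, m) = B' (n.1, m)) (j : Fin 2) :
    vectorPotential B n j = vectorPotential B' n j := by
  rcases le_total 0 n.2 with hn | hn
  · exact vectorPotential_congr_of_nonneg hn (fun m _ => h m) j
  · exact vectorPotential_congr_of_nonpos hn (fun m _ => h m) j

/-- The standard potential of a field which depends on `n₁` only. -/
lemma vectorPotential_eq_mul (β : ℤ → ℝ) (n : Lattice) :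
    vectorPotential (fun n => β n.1) n 0 = n.2 * β n.1 := by
  simp only [vectorPotential, if_true, Finset.sum_const, Int.card_Icc, nsmul_eq_mul]
  rcases lt_trichotomy n.2 0 with h | h | h
  · rw [if_neg (by lia), if_pos h, abs_of_neg h]
    have : (((-n.2 - 1 + 1 - 0).toNat : ℤ) : ℝ) = ((-n.2 : ℤ) : ℝ) := by
      rw [Int.toNat_of_nonneg (by lia)]; congr 1; ring
    rw [Int.cast_natCast] at this
    rw [this]; push_cast; ring
  · simp [h]
  · rw [if_pos h, if_neg (by lia)]
    have : (((n.2 + 1 - 1).toNat : ℤ) : ℝ) = (n.2 : ℝ) := by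
      rw [Int.toNat_of_nonneg (by lia)]; congr 1; ring
    rw [Int.cast_natCast] at this
    rw [this]; ring

/-- Every function on `ℤ` has an antidifference. -/
lemma exists_antidifference (β : ℤ → ℝ) : ∃ h : ℤ → ℝ, ∀ m, h m - h (m - 1) = β m :=
  ⟨fun m => vectorPotential (fun n => β n.2) (0, m) 0, fun _ => vectorPotential_sub _ _ _⟩

/-! ### Projections onto sets of sites -/

@[simp] lemma siteProj_apply (S : Set Lattice) (ψ : L2) (n : Lattice) :
    (siteProj S ψ) n = S.indicator (fun _ => 1) n * ψ n := rfl

lemma norm_siteProj_le (S : Set Lattice) : ‖siteProj S‖ ≤ 1 := norm_mulOp_le _ _ _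

lemma siteProj_mul (S T : Set Lattice) : siteProj S * siteProj T = siteProj (S ∩ T) := by
  refine boundedOp_ext fun ψ n => ?_
  by_cases hS : n ∈ S <;> by_cases hT : n ∈ T <;> simp [hS, hT]

lemma siteProj_add_compl (S : Set Lattice) : siteProj S + siteProj Sᶜ = 1 := by
  refine boundedOp_ext fun ψ n => ?_
  by_cases hS : n ∈ S <;> simp [hS]

lemma star_siteProj (S : Set Lattice) : star (siteProj S) = siteProj S := by
  rw [siteProj, star_mulOp]
  refine boundedOp_ext fun ψ n => ?_
  by_cases hS : n ∈ S <;> simp [hS]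

lemma siteProj_sub {S T : Set Lattice} (h : T ⊆ S) :
    siteProj S - siteProj T = siteProj (S \ T) := by
  refine boundedOp_ext fun ψ n => ?_
  by_cases hT : n ∈ T
  · simp [hT, h hT]
  · by_cases hS : n ∈ S <;> simp [hS, hT]

@[simp] lemma siteProj_empty : siteProj ∅ = 0 := by
  refine boundedOp_ext fun ψ n => ?_
  simp

lemma siteProj_add_of_disjoint {S T : Set Lattice} (h : Disjoint S T) :
    siteProj S + siteProj T = siteProj (S ∪ T) := by
  refine boundedOp_ext fun ψ n => ?_
  by_cases hS : n ∈ S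
  · simp [hS, Set.disjoint_left.1 h hS]
  · by_cases hT : n ∈ T <;> simp [hS, hT]

/-! ### The canonical basis of `ℓ²(ℤ²)` -/

/-- The canonical basis vector at the site `n`. -/
noncomputable def delta (n : Lattice) : L2 := lp.single 2 n 1

lemma delta_apply (n m : Lattice) : (delta n) m = if m = n then 1 else 0 := by
  rw [delta, lp.single_apply, Pi.single_apply]

lemma norm_delta (n : Lattice) : ‖delta n‖ = 1 := by
  rw [delta, lp.norm_single (by norm_num), norm_one]

lemma inner_delta (n : Lattice) (ψ : L2) : inner ℂ (delta n) ψ = ψ n := by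
  rw [delta, lp.inner_single_left]
  simp

lemma hasSum_delta (ψ : L2) : HasSum (fun n => ψ n • delta n) ψ := by
  have h := lp.hasSum_single (p := 2) (by norm_num) ψ
  convert h using 2 with n
  rw [delta, ← lp.single_smul]
  simp

lemma eq_zero_of_apply_delta {T : BoundedOp} (h : ∀ n, T (delta n) = 0) : T = 0 := by
  ext1 ψ
  have h1 := (hasSum_delta ψ).mapL T
  simp only [map_smul, h, smul_zero] at h1
  exact h1.unique hasSum_zero

lemma siteProj_singleton (n : Lattice) :
    siteProj {n} = InnerProductSpace.rankOne ℂ (delta n) (delta n) := by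
  refine boundedOp_ext fun ψ m => ?_
  rw [InnerProductSpace.rankOne_apply, inner_delta]
  change _ = ψ n * delta n m
  rw [delta_apply, siteProj_apply]
  by_cases h : m = n <;> simp [h]

lemma magTranslation_delta (B : Lattice → ℝ) (j : Fin 2) (n : Lattice) :
    magTranslation B j (delta n) = phase B j (n + basisVec j) • delta (n + basisVec j) := by
  refine lp.ext (funext fun m => ?_)
  change _ = phase B j (n + basisVec j) * delta (n + basisVec j) m
  rw [magTranslation_apply, delta_apply, delta_apply]
  by_cases h : m = n + basisVec j
  · subst h; simp
  · rw [if_neg h, if_neg (by rwa [sub_eq_iff_eq_add])]; simp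

lemma star_magTranslation_delta (B : Lattice → ℝ) (j : Fin 2) (n : Lattice) :
    (star (magTranslation B j) : BoundedOp) (delta n)
      = star (phase B j n) • delta (n - basisVec j) := by
  refine lp.ext (funext fun m => ?_)
  change _ = star (phase B j n) * delta (n - basisVec j) m
  rw [star_magTranslation_apply, delta_apply, delta_apply]
  by_cases h : m = n - basisVec j
  · subst h; simp
  · rw [if_neg h, if_neg (by rwa [← eq_sub_iff_add_eq])]; simp

/-! ### The flux operator and projections in magnetic algebras -/

/-- Around a cell only the two hops along `e₁`, at adjacent heights, contribute phases. The field is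
thereby recovered from the generators. -/
lemma flux_apply (B : Lattice → ℝ) (ψ : L2) (n : Lattice) :
    ((magTranslation B 0 * magTranslation B 1 * star (magTranslation B 0)
      * star (magTranslation B 1) : BoundedOp) ψ) n = Complex.exp (Complex.I * B n) * ψ n := by
  obtain ⟨a, b⟩ := n
  have h := vectorPotential_sub B a b
  simp only [mul_apply_eq, magTranslation_apply, star_magTranslation_apply, phase_one, star_one,
    one_mul]
  rw [← mul_assoc]
  congr 1
  · rw [← h, phase, phase, RCLike.star_def, ← Complex.exp_conj, ← Complex.exp_add]
    simp [basisVec, sub_eq_add_neg, mul_add]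
  · abel_nf

/-- The hypothesis on the two field values acts solely through this inequality of fluxes. -/
lemma exp_field_ne {bcor bstar : ℝ} (hb : ∀ k : ℤ, bcor - bstar ≠ 2 * Real.pi * k) :
    Complex.exp (Complex.I * bcor) ≠ Complex.exp (Complex.I * bstar) := by
  intro h
  obtain ⟨k, hk⟩ := Complex.exp_eq_exp_iff_exists_int.1 h
  apply hb k
  have : (bcor : ℂ) = bstar + 2 * Real.pi * k := by
    apply mul_left_cancel₀ Complex.I_ne_zero
    rw [hk]; ring
  have h2 : bcor = bstar + 2 * Real.pi * k := by exact_mod_cast this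
  linarith

/-- If a field takes two values with different fluxes, the projection onto the set where it takes
the first value belongs to the magnetic algebra. -/
lemma siteProj_mem_of_field {B : Lattice → ℝ} {bcor bstar : ℝ}
    (hb : ∀ k : ℤ, bcor - bstar ≠ 2 * Real.pi * k) (S : Set Lattice)
    (h1 : ∀ n ∈ S, B n = bcor) (h2 : ∀ n ∉ S, B n = bstar) : siteProj S ∈ magAlgebra B := by
  have hne := sub_ne_zero.2 (exp_field_ne hb)
  -- The affine function taking `exp(i bcor)` to 1 and `exp(i bstar)` to 0, applied to the flux
  -- operator.
  have e : siteProj S = (Complex.exp (Complex.I * bcor) - Complex.exp (Complex.I * bstar))⁻¹ •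
      (magTranslation B 0 * magTranslation B 1 * star (magTranslation B 0)
        * star (magTranslation B 1) - Complex.exp (Complex.I * bstar) • (1 : BoundedOp)) := by
    refine boundedOp_ext fun ψ n => ?_
    rw [smul_apply_apply, sub_apply_apply, flux_apply, smul_apply_apply, one_apply_apply, ← sub_mul,
      ← mul_assoc, siteProj_apply]
    congr 1
    by_cases h : n ∈ S
    · rw [h1 n h, inv_mul_cancel₀ hne]; simp [h]
    · rw [h2 n h]; simp [h]
  rw [e]
  have m0 := magTranslation_mem B 0
  have m1 := magTranslation_mem B 1
  exact (magAlgebra B).smul_mem (sub_mem (mul_mem (mul_mem (mul_mem m0 m1) (star_mem m0))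
    (star_mem m1)) ((magAlgebra B).smul_mem (one_mem _) _)) _

/-- The phases cancel under conjugation, so projections onto sites move as under ordinary
translations. -/
lemma magTranslation_conj_siteProj (B : Lattice → ℝ) (j : Fin 2) (S : Set Lattice) :
    magTranslation B j * siteProj S * star (magTranslation B j)
      = siteProj {n | n - basisVec j ∈ S} := by
  refine boundedOp_ext fun ψ n => ?_
  simp only [mul_apply_eq, magTranslation_apply, siteProj_apply, star_magTranslation_apply,
    sub_add_cancel]
  have := star_phase_mul_phase B j n
  have e : ({n | n - basisVec j ∈ S} : Set Lattice).indicator (fun _ => (1 : ℂ)) n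
    = S.indicator (fun _ => 1) (n - basisVec j) := rfl
  rw [e]
  linear_combination (S.indicator (fun _ => (1 : ℂ)) (n - basisVec j) * ψ n) * this

lemma star_magTranslation_conj_siteProj (B : Lattice → ℝ) (j : Fin 2) (S : Set Lattice) :
    star (magTranslation B j) * siteProj S * magTranslation B j
      = siteProj {n | n + basisVec j ∈ S} := by
  refine boundedOp_ext fun ψ n => ?_
  simp only [mul_apply_eq, magTranslation_apply, siteProj_apply, star_magTranslation_apply,
    add_sub_cancel_right]
  have := star_phase_mul_phase B j (n + basisVec j)
  have e : ({n | n + basisVec j ∈ S} : Set Lattice).indicator (fun _ => (1 : ℂ)) n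
    = S.indicator (fun _ => 1) (n + basisVec j) := rfl
  rw [e]
  linear_combination (S.indicator (fun _ => (1 : ℂ)) (n + basisVec j) * ψ n) * this

lemma siteProj_shift_basis_mem {B : Lattice → ℝ} {S : Set Lattice} (h : siteProj S ∈ magAlgebra B)
    (j : Fin 2) (k : ℤ) : siteProj {n | n - k • basisVec j ∈ S} ∈ magAlgebra B := by
  have m := magTranslation_mem B j
  induction k with
  | zero => simpa using h
  | succ k ih =>
    have := mul_mem (mul_mem m ih) (star_mem m)
    rw [magTranslation_conj_siteProj] at this
    convert this using 4 with n
    change _ ↔ n - basisVec j - (k : ℤ) • basisVec j ∈ S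
    rw [add_smul, one_smul, sub_sub, add_comm (basisVec j)]
  | pred k ih =>
    have := mul_mem (mul_mem (star_mem m) ih) m
    rw [star_magTranslation_conj_siteProj] at this
    convert this using 4 with n
    change _ ↔ n + basisVec j - (-(k : ℤ)) • basisVec j ∈ S
    rw [sub_smul, one_smul, ← sub_add, sub_add_eq_add_sub]

/-- Translates of a projection in a magnetic algebra belong to it. -/
lemma siteProj_shift_mem {B : Lattice → ℝ} {S : Set Lattice} (h : siteProj S ∈ magAlgebra B)
    (v : Lattice) : siteProj {n | n - v ∈ S} ∈ magAlgebra B := by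
  have h1 := siteProj_shift_basis_mem (siteProj_shift_basis_mem h 0 v.1) 1 v.2
  convert h1 using 4 with n
  change _ ↔ n - v.2 • basisVec 1 - v.1 • basisVec 0 ∈ S
  rw [show v = v.2 • basisVec 1 + v.1 • basisVec 0 by ext <;> simp [basisVec], ← sub_sub]
  simp [basisVec]

/-! ### Asymptotics of operators along a region. -/

/-- A decreasing sequence of sets of sites, each of which contains the unit neighbourhood of the
next one. -/
structure IsRegion (W : ℕ → Set Lattice) : Prop where
  antitone : Antitone W
  add_mem : ∀ N n j, n ∈ W (N + 1) → n + basisVec j ∈ W N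
  sub_mem : ∀ N n j, n ∈ W (N + 1) → n - basisVec j ∈ W N
  exists_notMem : ∀ n, ∃ N, n ∉ W N

/-- `T` is asymptotically zero in the region `W`. -/
def VanishesAlong (W : ℕ → Set Lattice) (T : BoundedOp) : Prop :=
  Tendsto (fun N => T * siteProj (W N)) atTop (𝓝 0)

/-- `T` propagates from far out in the region `W` only to points far out in `W`. -/
def IsLocalAlong (W : ℕ → Set Lattice) (T : BoundedOp) : Prop :=
  ∀ M, VanishesAlong W (siteProj (W M)ᶜ * T)

lemma isClosed_vanishesAlong (W : ℕ → Set Lattice) : IsClosed {T | VanishesAlong W T} := by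
  refine isClosed_of_closure_subset fun T hT => ?_
  rw [Metric.mem_closure_iff] at hT
  refine Metric.tendsto_atTop.2 fun ε hε => ?_
  obtain ⟨S, hS, hST⟩ := hT (ε / 2) (half_pos hε)
  obtain ⟨N, hN⟩ := Metric.tendsto_atTop.1 hS (ε / 2) (half_pos hε)
  refine ⟨N, fun n hn => ?_⟩
  have h1 := hN n hn
  rw [dist_zero_right] at h1 ⊢
  rw [dist_eq_norm] at hST
  have h2 : ‖(T - S) * siteProj (W n)‖ ≤ ‖T - S‖ :=
    (norm_mul_le _ _).trans (mul_le_of_le_one_right (norm_nonneg _) (norm_siteProj_le _))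
  have h3 : T * siteProj (W n) = (T - S) * siteProj (W n) + S * siteProj (W n) := by
    rw [← add_mul, sub_add_cancel]
  rw [h3]
  exact (norm_add_le _ _).trans_lt (by linarith)

lemma VanishesAlong.add {W : ℕ → Set Lattice} {S T : BoundedOp} (hS : VanishesAlong W S)
    (hT : VanishesAlong W T) : VanishesAlong W (S + T) := by
  have := Tendsto.add hS hT
  simpa only [add_zero, ← add_mul, VanishesAlong] using this

lemma VanishesAlong.mul_left {W : ℕ → Set Lattice} {T : BoundedOp} (S : BoundedOp)
    (hT : VanishesAlong W T) : VanishesAlong W (S * T) := by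
  have := Tendsto.const_mul S hT
  simpa only [mul_zero, ← mul_assoc, VanishesAlong] using this

lemma VanishesAlong.neg {W : ℕ → Set Lattice} {T : BoundedOp}
    (hT : VanishesAlong W T) : VanishesAlong W (-T) := by
  have := Tendsto.neg hT
  simpa only [neg_zero, ← neg_mul, VanishesAlong] using this

lemma VanishesAlong.sub {W : ℕ → Set Lattice} {S T : BoundedOp} (hS : VanishesAlong W S)
    (hT : VanishesAlong W T) : VanishesAlong W (S - T) := by
  rw [sub_eq_add_neg]; exact hS.add hT.neg

lemma vanishesAlong_of_eq_zero {W : ℕ → Set Lattice} {T : BoundedOp} (N : ℕ)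
    (h : ∀ n ≥ N, T * siteProj (W n) = 0) : VanishesAlong W T :=
  tendsto_const_nhds.congr' (eventually_atTop.2 ⟨N, fun n hn => (h n hn).symm⟩)

/-- Vanishing is stable under left multiplication, but on the right locality is needed: the output
of `T` inside `W M` meets a small `S`, and its output outside `W M` is itself small. -/
lemma VanishesAlong.mul_right {W : ℕ → Set Lattice} {S T : BoundedOp} (hS : VanishesAlong W S)
    (hT : IsLocalAlong W T) : VanishesAlong W (S * T) := by
  refine Metric.tendsto_atTop.2 fun ε hε => ?_
  have hT0 : 0 < ‖T‖ + 1 := by positivity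
  obtain ⟨M, hM⟩ := Metric.tendsto_atTop.1 hS (ε / 2 / (‖T‖ + 1)) (by positivity)
  obtain ⟨N, hN⟩ := Metric.tendsto_atTop.1 ((hT M).mul_left S) (ε / 2) (half_pos hε)
  refine ⟨N, fun n hn => ?_⟩
  have h1 := hM M le_rfl
  have h2 := hN n hn
  rw [dist_zero_right] at h1 h2 ⊢
  have e : S * T * siteProj (W n)
      = S * siteProj (W M) * T * siteProj (W n)
        + S * (siteProj (W M)ᶜ * T) * siteProj (W n) := by
    conv_lhs => rw [← mul_one S, ← siteProj_add_compl (W M)]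
    simp only [mul_add, add_mul, mul_assoc]
  rw [e]
  have h3 : ‖S * siteProj (W M) * T * siteProj (W n)‖ ≤ ‖S * siteProj (W M)‖ * (‖T‖ + 1) := by
    calc _ ≤ ‖S * siteProj (W M)‖ * ‖T‖ * ‖siteProj (W n)‖ :=
          (norm_mul_le _ _).trans (mul_le_mul_of_nonneg_right (norm_mul_le _ _) (norm_nonneg _))
      _ ≤ ‖S * siteProj (W M)‖ * ‖T‖ :=
          mul_le_of_le_one_right (by positivity) (norm_siteProj_le _)
      _ ≤ _ := mul_le_mul_of_nonneg_left (by linarith) (norm_nonneg _)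
  have h4 : ‖S * siteProj (W M)‖ * (‖T‖ + 1) < ε / 2 := by
    rwa [lt_div_iff₀ hT0] at h1
  exact (norm_add_le _ _).trans_lt (by linarith)

/-- The algebra of pairs of operators which agree asymptotically in the region `W`. -/
def asymptoticPairs {W : ℕ → Set Lattice} (hW : IsRegion W) :
    Subalgebra ℂ (BoundedOp × BoundedOp) where
  carrier := {z | VanishesAlong W (z.1 - z.2) ∧ IsLocalAlong W z.2}
  mul_mem' := by
    rintro ⟨x, y⟩ ⟨x', y'⟩ ⟨h1, h2⟩ ⟨h3, h4⟩
    refine ⟨?_, fun M => ?_⟩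
    · change VanishesAlong W (x * x' - y * y')
      -- With this splitting only `y'` stands to the right of a vanishing factor, so locality is
      -- required of second components alone.
      have e : x * x' - y * y' = x * (x' - y') + (x - y) * y' := by
        rw [mul_sub, sub_mul]; abel
      rw [e]
      exact (h3.mul_left x).add (h1.mul_right h4)
    · change VanishesAlong W (siteProj (W M)ᶜ * (y * y'))
      rw [← mul_assoc]
      exact (h2 M).mul_right h4
  add_mem' := by
    rintro ⟨x, y⟩ ⟨x', y'⟩ ⟨h1, h2⟩ ⟨h3, h4⟩
    refine ⟨?_, fun M => ?_⟩
    · change VanishesAlong W (x + x' - (y + y'))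
      rw [add_sub_add_comm]
      exact h1.add h3
    · change VanishesAlong W (siteProj (W M)ᶜ * (y + y'))
      rw [mul_add]
      exact (h2 M).add (h4 M)
  algebraMap_mem' c := by
    refine ⟨?_, fun M => ?_⟩
    · refine vanishesAlong_of_eq_zero 0 fun n _ => ?_
      change (algebraMap ℂ BoundedOp c - algebraMap ℂ BoundedOp c) * _ = 0
      rw [sub_self, zero_mul]
    · refine vanishesAlong_of_eq_zero M fun n hn => ?_
      change siteProj (W M)ᶜ * (algebraMap ℂ BoundedOp c) * siteProj (W n) = 0
      rw [← Algebra.commutes, mul_assoc, siteProj_mul]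
      have : (W M)ᶜ ∩ W n = ∅ :=
        Set.disjoint_iff_inter_eq_empty.1
          (Set.disjoint_left.2 fun x hx hx' => hx (hW.antitone hn hx'))
      rw [this, siteProj_empty, mul_zero]

lemma isClosed_asymptoticPairs {W : ℕ → Set Lattice} (hW : IsRegion W) :
    IsClosed (asymptoticPairs hW : Set (BoundedOp × BoundedOp)) := by
  have e : (asymptoticPairs hW : Set (BoundedOp × BoundedOp))
      = (fun z => z.1 - z.2) ⁻¹' {T | VanishesAlong W T}
        ∩ ⋂ M, (fun z => siteProj (W M)ᶜ * z.2) ⁻¹' {T | VanishesAlong W T} := by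
    ext z
    simp only [Set.mem_inter_iff, Set.mem_iInter, Set.mem_preimage]
    rfl
  rw [e]
  exact ((isClosed_vanishesAlong W).preimage (by fun_prop)).inter
    (isClosed_iInter fun M => (isClosed_vanishesAlong W).preimage (by fun_prop))

/-- The potentials of `B` and `B'` agree in the region `W`. -/
def AgreeOn (B B' : Lattice → ℝ) (W : ℕ → Set Lattice) : Prop :=
  ∀ n ∈ W 0, ∀ j, vectorPotential B n j = vectorPotential B' n j

lemma magTranslation_mem_asymptoticPairs {W : ℕ → Set Lattice} (hW : IsRegion W)
    {B B' : Lattice → ℝ} (h : AgreeOn B B' W) (j : Fin 2) :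
    (magTranslation B j, magTranslation B' j) ∈ asymptoticPairs hW := by
  -- The phase is evaluated at the end `n` of the hop, one step away from `W N`; therefore the
  -- differences vanish from `N = 1` on.
  refine ⟨vanishesAlong_of_eq_zero 1 fun N hN => boundedOp_ext fun ψ n => ?_,
    fun M => vanishesAlong_of_eq_zero (M + 1) fun N hN => boundedOp_ext fun ψ n => ?_⟩
  · simp only [mul_apply_eq, sub_apply_apply, magTranslation_apply, siteProj_apply,
      zero_apply_apply]
    by_cases hn : n - basisVec j ∈ W N
    · have h0 := hW.add_mem 0 _ j (hW.antitone hN hn)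
      rw [sub_add_cancel] at h0
      rw [phase, phase, h n h0 j, sub_self]
    · simp [hn]
  · simp only [mul_apply_eq, magTranslation_apply, siteProj_apply, zero_apply_apply]
    by_cases hn : n - basisVec j ∈ W N
    · have h0 := hW.add_mem M _ j (hW.antitone hN hn)
      rw [sub_add_cancel] at h0
      simp [h0]
    · simp [hn]

lemma star_magTranslation_mem_asymptoticPairs {W : ℕ → Set Lattice} (hW : IsRegion W)
    {B B' : Lattice → ℝ} (h : AgreeOn B B' W) (j : Fin 2) :
    ((star (magTranslation B j) : BoundedOp), (star (magTranslation B' j) : BoundedOp))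
      ∈ asymptoticPairs hW := by
  -- For the adjoint the phase is evaluated at the start `n + basisVec j` of the hop, already in `W
  -- N`, so the threshold is 0.
  refine ⟨vanishesAlong_of_eq_zero 0 fun N hN => boundedOp_ext fun ψ n => ?_,
    fun M => vanishesAlong_of_eq_zero (M + 1) fun N hN => boundedOp_ext fun ψ n => ?_⟩
  · simp only [mul_apply_eq, sub_apply_apply, star_magTranslation_apply, siteProj_apply,
      zero_apply_apply]
    by_cases hn : n + basisVec j ∈ W N
    · rw [phase, phase, h _ (hW.antitone hN hn) j, sub_self]
    · simp [hn]
  · simp only [mul_apply_eq, star_magTranslation_apply, siteProj_apply, zero_apply_apply]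
    by_cases hn : n + basisVec j ∈ W N
    · have h0 := hW.sub_mem M _ j (hW.antitone hN hn)
      rw [add_sub_cancel_right] at h0
      simp [h0]
    · simp [hn]

/-! ### Transport into a region, and evaluation homomorphisms. -/

/-- Every site can be moved far into the region `W` by an isometry which commutes with the
magnetic translations. -/
def IsTransported (B : Lattice → ℝ) (W : ℕ → Set Lattice) : Prop :=
  ∀ n N, ∃ V : BoundedOp, (∀ ψ, ‖V ψ‖ = ‖ψ‖) ∧ (∀ j, Commute V (magTranslation B j)) ∧
    siteProj (W N) (V (delta n)) = V (delta n)

lemma commute_of_mem_magAlgebra {B : Lattice → ℝ} {V : BoundedOp}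
    (h : ∀ j, Commute V (magTranslation B j)) (a : magAlgebra B) : Commute V (a : BoundedOp) := by
  let S : Subalgebra ℂ (magAlgebra B) :=
    (Subalgebra.centralizer ℂ {V}).comap (magAlgebra B).subtype.toAlgHom
  have hS : IsClosed (S : Set (magAlgebra B)) := by
    have e : (S : Set (magAlgebra B)) = {a : magAlgebra B | V * (a : BoundedOp) = a * V} := by
      ext a
      change (a : BoundedOp) ∈ Subalgebra.centralizer ℂ {V} ↔ _
      rw [Subalgebra.mem_centralizer_iff]
      simp
    rw [e]
    exact isClosed_eq (by fun_prop) (by fun_prop)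
  have key : ∀ T : magAlgebra B, T ∈ S ↔ Commute V (T : BoundedOp) := fun T => by
    change (T : BoundedOp) ∈ Subalgebra.centralizer ℂ {V} ↔ _
    rw [Subalgebra.mem_centralizer_iff]
    simp [commute_iff_eq]
  exact (key a).1 (mem_of_generators (gen_generates B) S hS (fun j => (key _).2 (h j))
    (fun j => (key _).2 (commute_star_magTranslation (h j))) a)

/-- As `V` is an isometry commuting with `a`, the norm of `a (delta n)` equals that of `a (V (delta
n))`, and `V (delta n)` sits in `W N`. So this norm is bounded by a quantity tending to zero. -/
lemma eq_zero_of_vanishesAlong {B : Lattice → ℝ} {W : ℕ → Set Lattice} (hB : IsTransported B W)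
    (a : magAlgebra B) (ha : VanishesAlong W a) : a = 0 := by
  refine Subtype.ext (eq_zero_of_apply_delta fun n => ?_)
  have h : ∀ N, ‖(a : BoundedOp) (delta n)‖ ≤ ‖(a : BoundedOp) * siteProj (W N)‖ := fun N => by
    obtain ⟨V, hV, hc, hd⟩ := hB n N
    have e : V ((a : BoundedOp) (delta n)) = ((a : BoundedOp) * siteProj (W N)) (V (delta n)) := by
      rw [mul_apply_eq, hd, ← mul_apply_eq, ← mul_apply_eq, (commute_of_mem_magAlgebra hc a).eq]
    rw [← hV, e]
    refine (ContinuousLinearMap.le_opNorm _ _).trans_eq ?_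
    rw [hV, norm_delta, mul_one]
  have h0 : Tendsto (fun N => ‖(a : BoundedOp) * siteProj (W N)‖) atTop (𝓝 0) := by
    simpa using ha.norm
  exact norm_le_zero_iff.1 (ge_of_tendsto' h0 h)

/-- A `*`-homomorphism which respects the magnetic translations gives the asymptotics of the
elements in any region in which the potentials agree. -/
lemma mem_asymptoticPairs_of_gen {W : ℕ → Set Lattice} (hW : IsRegion W) {B B' : Lattice → ℝ}
    (h : AgreeOn B B' W) {φ : magAlgebra B →⋆ₐ[ℂ] magAlgebra B'}
    (hφ : ∀ j, φ (gen B j) = gen B' j) (a : magAlgebra B) :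
    ((a : BoundedOp), (φ a : BoundedOp)) ∈ asymptoticPairs hW := by
  let f : magAlgebra B →ₐ[ℂ] BoundedOp × BoundedOp :=
    ((magAlgebra B).subtype.prod ((magAlgebra B').subtype.comp φ)).toAlgHom
  have hf : Continuous f :=
    continuous_subtype_val.prodMk (continuous_subtype_val.comp (continuous_magAlgebra_hom φ))
  refine mem_of_generators (gen_generates B) ((asymptoticPairs hW).comap f)
    ((isClosed_asymptoticPairs hW).preimage hf) (fun j => ?_) (fun j => ?_) a
  · change ((gen B j : BoundedOp), (φ (gen B j) : BoundedOp)) ∈ asymptoticPairs hW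
    rw [hφ]
    exact magTranslation_mem_asymptoticPairs hW h j
  · change ((star (gen B j) : magAlgebra B).val, (φ (star (gen B j))).val) ∈ asymptoticPairs hW
    rw [map_star, hφ]
    exact star_magTranslation_mem_asymptoticPairs hW h j

/-- The relation of being asymptotically equal is single-valued, because transport makes elements of
the target determined by their asymptotics. -/
lemma exists_evaluation {W : ℕ → Set Lattice} (hW : IsRegion W) {B B' : Lattice → ℝ}
    (h : AgreeOn B B' W) (hB : IsTransported B' W) :
    ∃ φ : magAlgebra B →⋆ₐ[ℂ] magAlgebra B', ∀ j, φ (gen B j) = gen B' j := by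
  let f : magAlgebra B × magAlgebra B' →ₐ[ℂ] BoundedOp × BoundedOp :=
    AlgHom.prodMap (magAlgebra B).subtype.toAlgHom (magAlgebra B').subtype.toAlgHom
  have hf : Continuous f := continuous_subtype_val.prodMap continuous_subtype_val
  have := isClosed_magAlgebra B
  have := isClosed_magAlgebra B'
  refine exists_starAlgHom_of_relation (gen_generates B) ((asymptoticPairs hW).comap f)
    ((isClosed_asymptoticPairs hW).preimage hf)
    (fun j => magTranslation_mem_asymptoticPairs hW h j)
    (fun j => star_magTranslation_mem_asymptoticPairs hW h j) fun b hb => ?_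
  refine eq_zero_of_vanishesAlong hB b ?_
  have h1 : VanishesAlong W ((0 : BoundedOp) - b) := hb.1
  simpa using h1.neg

lemma evaluation_surjective {B B' : Lattice → ℝ} {φ : magAlgebra B →⋆ₐ[ℂ] magAlgebra B'}
    (hφ : ∀ j, φ (gen B j) = gen B' j) : Function.Surjective φ := by
  have := isClosed_magAlgebra B
  have := isClosed_magAlgebra B'
  exact surjective_of_generators φ (gen B') (gen_generates B') fun j => ⟨_, hφ j⟩

lemma vanishesAlong_of_map_eq_zero {W : ℕ → Set Lattice} (hW : IsRegion W) {B B' : Lattice → ℝ}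
    (h : AgreeOn B B' W) {φ : magAlgebra B →⋆ₐ[ℂ] magAlgebra B'}
    (hφ : ∀ j, φ (gen B j) = gen B' j) {a : magAlgebra B} (ha : φ a = 0) : VanishesAlong W a := by
  have := (mem_asymptoticPairs_of_gen hW h hφ a).1
  simpa [ha] using this

lemma map_eq_zero_of_vanishesAlong {W : ℕ → Set Lattice} (hW : IsRegion W) {B B' : Lattice → ℝ}
    (h : AgreeOn B B' W) (hB : IsTransported B' W) {φ : magAlgebra B →⋆ₐ[ℂ] magAlgebra B'}
    (hφ : ∀ j, φ (gen B j) = gen B' j) {a : magAlgebra B} (ha : VanishesAlong W a) : φ a = 0 := by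
  refine eq_zero_of_vanishesAlong hB _ ?_
  have h1 : VanishesAlong W ((a : BoundedOp) - φ a) := (mem_asymptoticPairs_of_gen hW h hφ a).1
  simpa using ha.sub h1

/-- Serves to compute images of projections: any element of the target with the same asymptotics is
the image. -/
lemma map_eq_of_vanishesAlong_sub {W : ℕ → Set Lattice} (hW : IsRegion W) {B B' : Lattice → ℝ}
    (h : AgreeOn B B' W) (hB : IsTransported B' W) {φ : magAlgebra B →⋆ₐ[ℂ] magAlgebra B'}
    (hφ : ∀ j, φ (gen B j) = gen B' j) {a : magAlgebra B} {b : magAlgebra B'}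
    (hab : VanishesAlong W ((a : BoundedOp) - b)) : φ a = b := by
  refine sub_eq_zero.1 (eq_zero_of_vanishesAlong hB _ ?_)
  have h1 : VanishesAlong W ((a : BoundedOp) - φ a) := (mem_asymptoticPairs_of_gen hW h hφ a).1
  simpa using hab.sub h1

/-! ### The four half-plane regions -/

/-- The upper half-planes `n₂ ≥ N`. -/
def upRegion (N : ℕ) : Set Lattice := {n | (N : ℤ) ≤ n.2}

/-- The right half-planes `n₁ > N`. -/
def rightRegion (N : ℕ) : Set Lattice := {n | (N : ℤ) < n.1}

/-- The lower half-planes `n₂ ≤ -N`. -/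
def downRegion (N : ℕ) : Set Lattice := {n | n.2 ≤ -(N : ℤ)}

/-- The left half-planes `n₁ ≤ -N`. -/
def leftRegion (N : ℕ) : Set Lattice := {n | n.1 ≤ -(N : ℤ)}

lemma basisVec_cases (j : Fin 2) : basisVec j = (1, 0) ∨ basisVec j = (0, 1) := by
  fin_cases j <;> simp [basisVec]

lemma isRegion_up : IsRegion upRegion where
  antitone := fun N M h n (hn : (M : ℤ) ≤ n.2) => show (N : ℤ) ≤ n.2 by lia
  add_mem N n j (hn : ((N + 1 : ℕ) : ℤ) ≤ n.2) := by
    change (N : ℤ) ≤ n.2 + (basisVec j).2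
    rcases basisVec_cases j with h | h <;> rw [h] <;> dsimp only <;> lia
  sub_mem N n j (hn : ((N + 1 : ℕ) : ℤ) ≤ n.2) := by
    change (N : ℤ) ≤ n.2 - (basisVec j).2
    rcases basisVec_cases j with h | h <;> rw [h] <;> dsimp only <;> lia
  exists_notMem n := ⟨n.2.natAbs + 1, fun (h : ((n.2.natAbs + 1 : ℕ) : ℤ) ≤ n.2) => by lia⟩

lemma isRegion_right : IsRegion rightRegion where
  antitone := fun N M h n (hn : (M : ℤ) < n.1) => show (N : ℤ) < n.1 by lia
  add_mem N n j (hn : ((N + 1 : ℕ) : ℤ) < n.1) := by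
    change (N : ℤ) < n.1 + (basisVec j).1
    rcases basisVec_cases j with h | h <;> rw [h] <;> dsimp only <;> lia
  sub_mem N n j (hn : ((N + 1 : ℕ) : ℤ) < n.1) := by
    change (N : ℤ) < n.1 - (basisVec j).1
    rcases basisVec_cases j with h | h <;> rw [h] <;> dsimp only <;> lia
  exists_notMem n := ⟨n.1.natAbs + 1, fun (h : ((n.1.natAbs + 1 : ℕ) : ℤ) < n.1) => by lia⟩

lemma isRegion_down : IsRegion downRegion where
  antitone := fun N M h n (hn : n.2 ≤ -(M : ℤ)) => show n.2 ≤ -(N : ℤ) by lia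
  add_mem N n j (hn : n.2 ≤ -((N + 1 : ℕ) : ℤ)) := by
    change n.2 + (basisVec j).2 ≤ -(N : ℤ)
    rcases basisVec_cases j with h | h <;> rw [h] <;> dsimp only <;> lia
  sub_mem N n j (hn : n.2 ≤ -((N + 1 : ℕ) : ℤ)) := by
    change n.2 - (basisVec j).2 ≤ -(N : ℤ)
    rcases basisVec_cases j with h | h <;> rw [h] <;> dsimp only <;> lia
  exists_notMem n := ⟨n.2.natAbs + 1, fun (h : n.2 ≤ -((n.2.natAbs + 1 : ℕ) : ℤ)) => by lia⟩

lemma isRegion_left : IsRegion leftRegion where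
  antitone := fun N M h n (hn : n.1 ≤ -(M : ℤ)) => show n.1 ≤ -(N : ℤ) by lia
  add_mem N n j (hn : n.1 ≤ -((N + 1 : ℕ) : ℤ)) := by
    change n.1 + (basisVec j).1 ≤ -(N : ℤ)
    rcases basisVec_cases j with h | h <;> rw [h] <;> dsimp only <;> lia
  sub_mem N n j (hn : n.1 ≤ -((N + 1 : ℕ) : ℤ)) := by
    change n.1 - (basisVec j).1 ≤ -(N : ℤ)
    rcases basisVec_cases j with h | h <;> rw [h] <;> dsimp only <;> lia
  exists_notMem n := ⟨n.1.natAbs + 1, fun (h : n.1 ≤ -((n.1.natAbs + 1 : ℕ) : ℤ)) => by lia⟩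

/-! ### Gauge translations commuting with the magnetic translations. -/

/-- A weighted translation with unimodular weights. -/
noncomputable def gaugeTranslation (h : Lattice → ℝ) (v : Lattice) : BoundedOp :=
  mulOp (fun n => Complex.exp (Complex.I * (h n : ℂ))) 1
    (fun _ => (Complex.norm_exp_I_mul_ofReal _).le) * translation v

@[simp] lemma gaugeTranslation_apply (h : Lattice → ℝ) (v : Lattice) (ψ : L2) (n : Lattice) :
    (gaugeTranslation h v ψ) n = Complex.exp (Complex.I * (h n : ℂ)) * ψ (n - v) := rfl

lemma norm_gaugeTranslation (h : Lattice → ℝ) (v : Lattice) (ψ : L2) :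
    ‖gaugeTranslation h v ψ‖ = ‖ψ‖ := by
  have e : ‖gaugeTranslation h v ψ‖ ^ (2 : ℝ≥0∞).toReal = ‖ψ‖ ^ (2 : ℝ≥0∞).toReal := by
    rw [lp.norm_rpow_eq_tsum two_toReal_pos, lp.norm_rpow_eq_tsum two_toReal_pos,
      ← (Equiv.subRight v).tsum_eq fun n : Lattice => ‖(ψ n : ℂ)‖ ^ (2 : ℝ≥0∞).toReal]
    refine tsum_congr fun n => ?_
    rw [gaugeTranslation_apply, norm_mul, Complex.norm_exp_I_mul_ofReal, one_mul]
    rfl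
  exact (Real.rpow_left_inj (norm_nonneg _) (norm_nonneg _) two_toReal_pos.ne').1 e

lemma siteProj_gaugeTranslation_delta (h : Lattice → ℝ) {v n : Lattice} {S : Set Lattice}
    (hn : n + v ∈ S) :
    siteProj S (gaugeTranslation h v (delta n)) = gaugeTranslation h v (delta n) := by
  refine lp.ext (funext fun m => ?_)
  rw [siteProj_apply, gaugeTranslation_apply, delta_apply]
  split_ifs with hm
  · rw [sub_eq_iff_eq_add] at hm
    subst hm; simp [hn]
  · simp

/-- The hypothesis says that the potential translated by `v` differs from the original by a discrete
gradient of `h`, that is, by a gauge transformation. -/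
lemma commute_gaugeTranslation {B : Lattice → ℝ} {h : Lattice → ℝ} {v : Lattice} {j : Fin 2}
    (hh : ∀ n, h n + vectorPotential B (n - v) j
      = vectorPotential B n j + h (n - basisVec j)) :
    Commute (gaugeTranslation h v) (magTranslation B j) := by
  refine boundedOp_ext fun ψ n => ?_
  simp only [mul_apply_eq, gaugeTranslation_apply, magTranslation_apply]
  rw [← mul_assoc, ← mul_assoc, phase, phase, ← Complex.exp_add, ← Complex.exp_add, ← mul_add,
    ← mul_add, ← Complex.ofReal_add, ← Complex.ofReal_add, hh n, sub_right_comm]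

/-- A field which depends on `n₁` only is invariant in the vertical direction. -/
lemma exists_vertical_transport (β : ℤ → ℝ) (k : ℤ) (n : Lattice) {S : Set Lattice}
    (hn : n + (0, k) ∈ S) :
    ∃ V : BoundedOp, (∀ ψ, ‖V ψ‖ = ‖ψ‖) ∧
      (∀ j, Commute V (magTranslation (fun n => β n.1) j)) ∧
      siteProj S (V (delta n)) = V (delta n) := by
  obtain ⟨h, hh⟩ := exists_antidifference β
  -- The potential is `n₂ β(n₁)`; a vertical shift by `k` changes it by `-k β(n₁)`, which the
  -- antidifference of `β` compensates.
  refine ⟨gaugeTranslation (fun m => k * h m.1) (0, k), norm_gaugeTranslation _ _, fun j => ?_,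
    siteProj_gaugeTranslation_delta _ hn⟩
  refine commute_gaugeTranslation fun m => ?_
  obtain rfl | rfl : j = 0 ∨ j = 1 := by fin_cases j <;> simp
  · rw [vectorPotential_eq_mul, vectorPotential_eq_mul]
    have := hh m.1
    simp only [basisVec, if_true, Prod.fst_sub, Prod.snd_sub, sub_zero, Int.cast_sub]
    rw [← this]; ring
  · simp [vectorPotential_one, basisVec]

/-- A field which depends on `n₂` only is invariant in the horizontal direction. -/
lemma exists_horizontal_transport (β : ℤ → ℝ) (k : ℤ) (n : Lattice) {S : Set Lattice}
    (hn : n + (k, 0) ∈ S) :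
    ∃ V : BoundedOp, (∀ ψ, ‖V ψ‖ = ‖ψ‖) ∧
      (∀ j, Commute V (magTranslation (fun n => β n.2) j)) ∧
      siteProj S (V (delta n)) = V (delta n) := by
  -- The potential does not depend on `n₁`, so a plain translation suffices.
  refine ⟨gaugeTranslation (fun _ => 0) (k, 0), norm_gaugeTranslation _ _, fun j => ?_,
    siteProj_gaugeTranslation_delta _ hn⟩
  refine commute_gaugeTranslation fun m => ?_
  simp [vectorPotential]

lemma isTransported_up (β : ℤ → ℝ) : IsTransported (fun n => β n.1) upRegion := fun n N =>
  exists_vertical_transport β (N - n.2) n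
    (show (N : ℤ) ≤ n.2 + (N - n.2) by lia)

lemma isTransported_down (β : ℤ → ℝ) : IsTransported (fun n => β n.1) downRegion := fun n N =>
  exists_vertical_transport β (-N - n.2) n
    (show n.2 + (-N - n.2) ≤ -(N : ℤ) by lia)

lemma isTransported_right (β : ℤ → ℝ) : IsTransported (fun n => β n.2) rightRegion := fun n N =>
  exists_horizontal_transport β (N + 1 - n.1) n
    (show (N : ℤ) < n.1 + (N + 1 - n.1) by lia)

lemma isTransported_left (β : ℤ → ℝ) : IsTransported (fun n => β n.2) leftRegion := fun n N =>
  exists_horizontal_transport β (-N - n.1) n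
    (show n.1 + (-N - n.1) ≤ -(N : ℤ) by lia)

/-! ### Agreement of the potentials in the half-planes -/

section Fields

variable (bcor bstar : ℝ)

/-- The row `n₂ = 0` may be included because every potential vanishes there. -/
lemma agreeOn_quarter_up : AgreeOn (quarterField bcor bstar) (upField bcor bstar) upRegion :=
  fun n hn j => vectorPotential_congr_of_nonneg (by exact hn) (fun m hm => by
    have : ¬ m ≤ 0 := by lia
    simp [quarterField, upField, this]) j

lemma agreeOn_quarter_right :
    AgreeOn (quarterField bcor bstar) (rightField bcor bstar) rightRegion :=
  fun n (hn : ((0 : ℕ) : ℤ) < n.1) j => vectorPotential_congr (fun m => by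
    have : ¬ n.1 ≤ 0 := by lia
    simp [quarterField, rightField, this]) j

lemma agreeOn_quarter_left : AgreeOn (quarterField bcor bstar) (constField bstar) leftRegion :=
  fun n (hn : n.1 ≤ -((0 : ℕ) : ℤ)) j => vectorPotential_congr (fun m => by
    have : n.1 ≤ 0 := by lia
    simp [quarterField, constField, this]) j

lemma agreeOn_quarter_down : AgreeOn (quarterField bcor bstar) (constField bstar) downRegion :=
  fun n (hn : n.2 ≤ -((0 : ℕ) : ℤ)) j => vectorPotential_congr_of_nonpos (by lia) (fun m hm => by
    simp [quarterField, constField, hm]) j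

lemma agreeOn_up_right : AgreeOn (upField bcor bstar) (constField bcor) rightRegion :=
  fun n (hn : ((0 : ℕ) : ℤ) < n.1) j => vectorPotential_congr (fun m => by
    have : ¬ n.1 ≤ 0 := by lia
    simp [upField, constField, this]) j

lemma agreeOn_up_left : AgreeOn (upField bcor bstar) (constField bstar) leftRegion :=
  fun n (hn : n.1 ≤ -((0 : ℕ) : ℤ)) j => vectorPotential_congr (fun m => by
    have : n.1 ≤ 0 := by lia
    simp [upField, constField, this]) j

lemma agreeOn_right_up : AgreeOn (rightField bcor bstar) (constField bcor) upRegion :=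
  fun n hn j => vectorPotential_congr_of_nonneg (by exact hn) (fun m hm => by
    have : ¬ m ≤ 0 := by lia
    simp [rightField, constField, this]) j

lemma agreeOn_right_down : AgreeOn (rightField bcor bstar) (constField bstar) downRegion :=
  fun n (hn : n.2 ≤ -((0 : ℕ) : ℤ)) j => vectorPotential_congr_of_nonpos (by lia) (fun m hm => by
    simp [rightField, constField, hm]) j

lemma isTransported_upField : IsTransported (upField bcor bstar) upRegion :=
  isTransported_up fun m => if m ≤ 0 then bstar else bcor

lemma isTransported_rightField : IsTransported (rightField bcor bstar) rightRegion :=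
  isTransported_right fun m => if m ≤ 0 then bstar else bcor

end Fields

/-! ### Compact operators -/

/-- Finite combinations of basis vectors are eventually killed, they are dense, and the projections
are contractions. -/
lemma tendsto_siteProj_apply {W : ℕ → Set Lattice} (hW : Antitone W) (hW' : ∀ n, ∃ N, n ∉ W N)
    (ψ : L2) : Tendsto (fun N => siteProj (W N) ψ) atTop (𝓝 0) := by
  choose f hf using hW'
  refine Metric.tendsto_atTop.2 fun ε hε => ?_
  obtain ⟨s, hs⟩ := eventually_atTop.1 (Metric.tendsto_nhds.1 (hasSum_delta ψ) ε hε)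
  have hs := hs s le_rfl
  refine ⟨s.sup f, fun N hN => ?_⟩
  have h0 : siteProj (W N) (∑ n ∈ s, ψ n • delta n) = 0 := by
    rw [map_sum]
    refine Finset.sum_eq_zero fun n hn => ?_
    have hnN : n ∉ W N := fun h => hf n (hW ((Finset.le_sup hn).trans hN) h)
    rw [map_smul]
    refine smul_eq_zero_of_right _ (lp.ext (funext fun m => ?_))
    rw [siteProj_apply, delta_apply]
    split_ifs with hm
    · subst hm; simp [hnN]
    · simp
  rw [dist_zero_right, ← sub_zero (siteProj (W N) ψ), ← h0, ← map_sub]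
  calc _ ≤ ‖siteProj (W N)‖ * ‖ψ - ∑ n ∈ s, ψ n • delta n‖ := ContinuousLinearMap.le_opNorm _ _
    _ ≤ ‖ψ - ∑ n ∈ s, ψ n • delta n‖ :=
        mul_le_of_le_one_left (norm_nonneg _) (norm_siteProj_le _)
    _ < ε := by rwa [← dist_eq_norm, dist_comm]

/-- Strong convergence of contractions is uniform on the totally bounded image of the unit ball. -/
lemma tendsto_siteProj_mul_compact {W : ℕ → Set Lattice} (hW : Antitone W)
    (hW' : ∀ n, ∃ N, n ∉ W N) {T : BoundedOp} (hT : IsCompactOperator T) :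
    Tendsto (fun N => siteProj (W N) * T) atTop (𝓝 0) := by
  refine Metric.tendsto_atTop.2 fun ε hε => ?_
  have hc := hT.isCompact_closure_image_closedBall (f := T.toLinearMap) 1
  obtain ⟨t, htf, ht⟩ := Metric.totallyBounded_iff.1 hc.totallyBounded (ε / 3) (by positivity)
  have hev : ∀ᶠ N in atTop, ∀ y ∈ t, dist (siteProj (W N) y) 0 < ε / 3 :=
    (eventually_all_finite htf).2 fun y _ =>
      Metric.tendsto_nhds.1 (tendsto_siteProj_apply hW hW' y) _ (by positivity)
  obtain ⟨N, hN⟩ := eventually_atTop.1 hev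
  refine ⟨N, fun n hn => ?_⟩
  rw [dist_zero_right]
  refine (ContinuousLinearMap.opNorm_le_of_unit_norm (C := 2 * ε / 3) (by positivity)
    fun x hx => ?_).trans_lt (by linarith)
  have hx' : T x ∈ closure (T '' Metric.closedBall 0 1) :=
    subset_closure ⟨x, by simp [hx], rfl⟩
  obtain ⟨y, hy, hxy⟩ := Set.mem_iUnion₂.1 (ht hx')
  have h1 := hN n hn y hy
  rw [dist_zero_right] at h1
  rw [Metric.mem_ball, dist_eq_norm] at hxy
  have e : (siteProj (W n) * T) x = siteProj (W n) (T x - y) + siteProj (W n) y := by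
    rw [← map_add, sub_add_cancel]; rfl
  rw [e]
  have h2 : ‖siteProj (W n) (T x - y)‖ ≤ ‖T x - y‖ :=
    (ContinuousLinearMap.le_opNorm _ _).trans
      (mul_le_of_le_one_left (norm_nonneg _) (norm_siteProj_le _))
  exact (norm_add_le _ _).trans (by linarith)

/-- Adjoints move the projection to the other side, where vanishing is measured. -/
lemma vanishesAlong_of_isCompactOperator {W : ℕ → Set Lattice} (hW : Antitone W)
    (hW' : ∀ n, ∃ N, n ∉ W N) {T : BoundedOp} (hT : IsCompactOperator T) : VanishesAlong W T := by
  have h := (continuous_star.tendsto _).comp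
    (tendsto_siteProj_mul_compact hW hW' (isCompactOperator_star hT))
  rw [star_zero] at h
  refine h.congr fun N => ?_
  simp [star_siteProj]

/-- Only additivity is asked of `I`, so that it may be the compact operators, a magnetic algebra, or
an ideal of one. -/
lemma mul_siteProj_mem_of_finite {M : Type*} [SetLike M BoundedOp] [AddSubmonoidClass M BoundedOp]
    (I : M) (T : BoundedOp) (h : ∀ n, T * siteProj {n} ∈ I) {S : Set Lattice} (hS : S.Finite) :
    T * siteProj S ∈ I := by
  induction S, hS using Set.Finite.induction_on with
  | empty => rw [siteProj_empty, mul_zero]; exact zero_mem I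
  | @insert n S hn _ ih =>
    rw [Set.insert_eq, ← siteProj_add_of_disjoint (Set.disjoint_singleton_left.2 hn), mul_add]
    exact add_mem (h n) ih

lemma isCompactOperator_siteProj {S : Set Lattice} (hS : S.Finite) :
    IsCompactOperator (siteProj S) := by
  have h := mul_siteProj_mem_of_finite compactOps 1 (fun n => ?_) hS
  · rwa [one_mul] at h
  · rw [one_mul, siteProj_singleton]
    exact (isCompactOperator_id.comp_clm (innerSL ℂ (delta n))).clm_comp
      (ContinuousLinearMap.toSpanSingleton ℂ (delta n))

/-- The complement of a box. -/
def outerRegion (N : ℕ) : Set Lattice :=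
  (upRegion N ∪ downRegion N) ∪ (rightRegion N ∪ leftRegion N)

lemma antitone_outerRegion : Antitone outerRegion := fun _ _ h =>
  Set.union_subset_union
    (Set.union_subset_union (isRegion_up.antitone h) (isRegion_down.antitone h))
    (Set.union_subset_union (isRegion_right.antitone h) (isRegion_left.antitone h))

lemma exists_notMem_outerRegion (n : Lattice) : ∃ N, n ∉ outerRegion N := by
  refine ⟨n.1.natAbs + n.2.natAbs + 1, ?_⟩
  simp only [outerRegion, upRegion, downRegion, rightRegion, leftRegion, Set.mem_union,
    Set.mem_ofPred_eq]
  lia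

lemma finite_compl_outerRegion (N : ℕ) : (outerRegion N)ᶜ.Finite := by
  refine ((Set.finite_Icc (-(N : ℤ)) N).prod (Set.finite_Icc (-(N : ℤ)) N)).subset fun n hn => ?_
  simp only [outerRegion, upRegion, downRegion, rightRegion, leftRegion, Set.mem_union,
    Set.mem_ofPred_eq, Set.mem_compl_iff] at hn
  simp only [Set.mem_prod, Set.mem_Icc]
  lia

lemma VanishesAlong.union {W W' : ℕ → Set Lattice} {T : BoundedOp} (h : VanishesAlong W T)
    (h' : VanishesAlong W' T) : VanishesAlong (fun N => W N ∪ W' N) T := by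
  have e : ∀ N, T * siteProj (W N ∪ W' N)
      = T * siteProj (W N) + T * siteProj (W' N) * siteProj (W N)ᶜ := fun N => by
    have hd : Disjoint (W N) (W' N ∩ (W N)ᶜ) :=
      Set.disjoint_left.2 fun x hx hx' => hx'.2 hx
    rw [mul_assoc, siteProj_mul, ← mul_add, siteProj_add_of_disjoint hd]
    congr 2
    ext x
    simp only [Set.mem_union, Set.mem_inter_iff, Set.mem_compl_iff]
    tauto
  have h0 : Tendsto (fun N => T * siteProj (W' N) * siteProj (W N)ᶜ) atTop (𝓝 0) := by
    refine squeeze_zero_norm (fun N => ?_) (by simpa using h'.norm)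
    exact (norm_mul_le _ _).trans (mul_le_of_le_one_right (norm_nonneg _) (norm_siteProj_le _))
  have := Tendsto.add h h0
  rw [add_zero] at this
  exact this.congr fun N => (e N).symm

/-- If `T` vanishes along `W`, it is the limit of its restrictions to the complements of `W`. -/
lemma VanishesAlong.tendsto_compl {W : ℕ → Set Lattice} {T : BoundedOp} (h : VanishesAlong W T) :
    Tendsto (fun N => T * siteProj (W N)ᶜ) atTop (𝓝 T) := by
  have := Tendsto.const_sub T h
  rw [sub_zero] at this
  refine this.congr fun N => ?_
  rw [sub_eq_iff_eq_add', ← mul_add, siteProj_add_compl, mul_one]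

/-- The four half-planes cover the complement of a finite box, so `T` is a norm limit of finite-rank
restrictions. -/
lemma isCompactOperator_of_vanishesAlong {T : BoundedOp} (h1 : VanishesAlong upRegion T)
    (h2 : VanishesAlong downRegion T) (h3 : VanishesAlong rightRegion T)
    (h4 : VanishesAlong leftRegion T) : IsCompactOperator T := by
  have h : VanishesAlong outerRegion T := (h1.union h2).union (h3.union h4)
  exact isCompactOperator_of_tendsto h.tendsto_compl (Eventually.of_forall fun N =>
    (isCompactOperator_siteProj (finite_compl_outerRegion N)).clm_comp T)

/-! ### Rank one operators in magnetic algebras -/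

/-- A magnetic translation sends a basis vector to a nonzero multiple of its neighbour, and the
phase can be divided out. -/
lemma rankOne_delta_shift_mem {B : Lattice → ℝ} {n : Lattice} {φ : L2}
    (h : InnerProductSpace.rankOne ℂ (delta n) φ ∈ magAlgebra B) (j : Fin 2) (k : ℤ) :
    InnerProductSpace.rankOne ℂ (delta (n + k • basisVec j)) φ ∈ magAlgebra B := by
  have m := magTranslation_mem B j
  induction k with
  | zero => simpa using h
  | succ k ih =>
    have h1 : magTranslation B j * InnerProductSpace.rankOne ℂ (delta (n + (k : ℤ) • basisVec j)) φ
        ∈ magAlgebra B := mul_mem m ih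
    rw [ContinuousLinearMap.mul_def, InnerProductSpace.comp_rankOne, magTranslation_delta, map_smul,
      add_assoc, ← add_one_zsmul] at h1
    have h2 := (magAlgebra B).smul_mem h1
      (phase B j (n + ((k : ℤ) + 1) • basisVec j))⁻¹
    rwa [smul_apply, smul_smul, inv_mul_cancel₀ (phase_ne_zero _ _ _),
      one_smul] at h2
  | pred k ih =>
    have h1 : (star (magTranslation B j) : BoundedOp)
        * InnerProductSpace.rankOne ℂ (delta (n + (-(k : ℤ)) • basisVec j)) φ
        ∈ magAlgebra B := mul_mem (star_mem m) ih
    rw [ContinuousLinearMap.mul_def, InnerProductSpace.comp_rankOne, star_magTranslation_delta,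
      map_smul, add_sub_assoc,
      show (-(k : ℤ)) • basisVec j - basisVec j = (-(k : ℤ) - 1) • basisVec j by
        rw [sub_smul, one_smul]] at h1
    have h2 := (magAlgebra B).smul_mem h1
      (star (phase B j (n + (-(k : ℤ)) • basisVec j)))⁻¹
    rwa [smul_apply, smul_smul,
      inv_mul_cancel₀ (star_ne_zero.2 (phase_ne_zero _ _ _)), one_smul] at h2

lemma rankOne_delta_mem {B : Lattice → ℝ} {φ : L2}
    (h : InnerProductSpace.rankOne ℂ (delta 0) φ ∈ magAlgebra B) (n : Lattice) :
    InnerProductSpace.rankOne ℂ (delta n) φ ∈ magAlgebra B := by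
  have := rankOne_delta_shift_mem (rankOne_delta_shift_mem h 0 n.1) 1 n.2
  convert this using 4
  ext <;> simp [basisVec]

lemma rankOne_mem {B : Lattice → ℝ} (h : siteProj {0} ∈ magAlgebra B) (ψ : L2) (m : Lattice) :
    InnerProductSpace.rankOne ℂ ψ (delta m) ∈ magAlgebra B := by
  rw [siteProj_singleton] at h
  -- The adjoint exchanges the two slots: the second slot is moved to `m` first, and the first slot
  -- stays free for the limit.
  have h1 := star_mem (rankOne_delta_mem h m)
  rw [ContinuousLinearMap.star_eq_adjoint, InnerProductSpace.adjoint_rankOne] at h1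
  have hc : Continuous fun χ : L2 => InnerProductSpace.rankOne ℂ χ (delta m) :=
    ((ContinuousLinearMap.apply' BoundedOp (starRingEnd ℂ) (delta m)).continuous.comp
      (InnerProductSpace.rankOne ℂ (E := L2) (F := L2)).continuous)
  refine (isClosed_magAlgebra B).mem_of_tendsto ((hc.tendsto ψ).comp (hasSum_delta ψ))
    (Eventually.of_forall fun s => ?_)
  change InnerProductSpace.rankOne ℂ (∑ n ∈ s, ψ n • delta n) (delta m) ∈ magAlgebra B
  rw [map_sum, sum_apply]
  refine sum_mem fun n _ => ?_
  rw [map_smul, smul_apply]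
  exact (magAlgebra B).smul_mem (rankOne_delta_mem h1 n) _

/-- `T` is the limit of its restrictions to boxes, which are sums of the rank one operators with
range spanned by `T (delta n)`. -/
lemma compact_mem_magAlgebra {B : Lattice → ℝ} (h : siteProj {0} ∈ magAlgebra B) {T : BoundedOp}
    (hT : IsCompactOperator T) : T ∈ magAlgebra B := by
  refine (isClosed_magAlgebra B).mem_of_tendsto
    (vanishesAlong_of_isCompactOperator antitone_outerRegion
      exists_notMem_outerRegion hT).tendsto_compl
    (Eventually.of_forall fun N => ?_)
  refine mul_siteProj_mem_of_finite (magAlgebra B) T (fun n => ?_) (finite_compl_outerRegion N)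
  rw [siteProj_singleton, ContinuousLinearMap.mul_def, InnerProductSpace.comp_rankOne]
  exact rankOne_mem h _ _

/-- Compact operators belong to the closed ideal generated by any `x` with
`siteProj {0} * x = siteProj {0}`. -/
lemma compact_mem_closedIdeal {B : Lattice → ℝ} (h : siteProj {0} ∈ magAlgebra B)
    {x : magAlgebra B} (hx : siteProj {0} * (x : BoundedOp) = siteProj {0}) {T : magAlgebra B}
    (hT : IsCompactOperator (T : BoundedOp)) : T ∈ closedIdeal x := by
  let I := TwoSidedIdeal.span {x}
  have hx' : x ∈ I := TwoSidedIdeal.subset_span rfl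
  have h0 : (⟨siteProj {0}, h⟩ : magAlgebra B) ∈ I := by
    have := I.mul_mem_left ⟨siteProj {0}, h⟩ x hx'
    rwa [show (⟨siteProj {0}, h⟩ : magAlgebra B) * x = ⟨siteProj {0}, h⟩ from
      Subtype.ext hx] at this
  let M : AddSubmonoid BoundedOp :=
    { carrier := {S | ∃ hS : S ∈ magAlgebra B, (⟨S, hS⟩ : magAlgebra B) ∈ I}
      zero_mem' := ⟨zero_mem _, I.zero_mem⟩
      add_mem' := fun ⟨hS, hS'⟩ ⟨hR, hR'⟩ => ⟨add_mem hS hR, I.add_mem hS' hR'⟩ }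
  have hM : ∀ n, 1 * siteProj {n} ∈ M := fun n => by
    have ha := rankOne_mem h (delta n) 0
    have hb := rankOne_mem h (delta 0) n
    refine ⟨by rw [one_mul, siteProj_singleton]; exact rankOne_mem h _ _, ?_⟩
    -- Matrix units conjugate the projection onto the origin into the one onto `n`.
    have := I.mul_mem_right _ ⟨_, hb⟩ (I.mul_mem_left ⟨_, ha⟩ _ h0)
    convert this using 1
    refine Subtype.ext ?_
    change 1 * siteProj {n} = InnerProductSpace.rankOne ℂ (delta n) (delta 0) * siteProj {0}
      * InnerProductSpace.rankOne ℂ (delta 0) (delta n)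
    rw [siteProj_singleton, siteProj_singleton, one_mul]
    simp only [ContinuousLinearMap.mul_def, InnerProductSpace.rankOne_comp_rankOne, inner_delta,
      delta_apply, if_true, one_smul]
  have hP : ∀ N, (1 : BoundedOp) * siteProj (outerRegion N)ᶜ ∈ M := fun N =>
    mul_siteProj_mem_of_finite M 1 hM (finite_compl_outerRegion N)
  choose hP hPI using hP
  have ht : Tendsto (fun N => T * ⟨_, hP N⟩) atTop (𝓝 T) := by
    rw [tendsto_subtype_rng]
    simpa using
      (vanishesAlong_of_isCompactOperator antitone_outerRegion
      exists_notMem_outerRegion hT).tendsto_compl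
  exact mem_closure_of_tendsto ht (Eventually.of_forall fun N => I.mul_mem_left _ _ (hPI N))

/-! ### Projections in the quarter-plane algebra and the bulk evaluations -/

lemma siteProj_diff_mem {B : Lattice → ℝ} {S T : Set Lattice} (hS : siteProj S ∈ magAlgebra B)
    (hT : siteProj T ∈ magAlgebra B) (h : T ⊆ S) : siteProj (S \ T) ∈ magAlgebra B := by
  rw [← siteProj_sub h]
  exact sub_mem hS hT

/-- The field equals `bcor` on the open quarter-plane and `bstar` off it; every other corner is a
translate. Differences of corners give the half-strips, the half-lines and the origin. -/
lemma corner_mem {bcor bstar : ℝ} (hb : ∀ k : ℤ, bcor - bstar ≠ 2 * Real.pi * k)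
    (a b : ℤ) : siteProj {n | a < n.1 ∧ b < n.2} ∈ quarterAlgebra bcor bstar := by
  have h : siteProj {n : Lattice | 0 < n.1 ∧ 0 < n.2} ∈ quarterAlgebra bcor bstar :=
    siteProj_mem_of_field hb _
      (fun n hn => if_neg (by rintro (h | h); exacts [not_lt.2 h hn.1, not_lt.2 h hn.2]))
      (fun n hn => if_pos (by
        simp only [Set.mem_ofPred_eq] at hn
        by_contra hc
        push Not at hc
        exact hn hc))
  have := siteProj_shift_mem h (a, b)
  simpa using this

lemma horizontal_strip_mem {bcor bstar : ℝ} (hb : ∀ k : ℤ, bcor - bstar ≠ 2 * Real.pi * k)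
    (a : ℤ) {b c : ℤ} (hbc : b ≤ c) :
    siteProj {n | a < n.1 ∧ b < n.2 ∧ n.2 ≤ c} ∈ quarterAlgebra bcor bstar := by
  have h := siteProj_diff_mem (corner_mem hb a b) (corner_mem hb a c)
    fun n hn => ⟨hn.1, hbc.trans_lt hn.2⟩
  convert h using 2
  ext n
  simp only [Set.mem_ofPred_eq, Set.mem_sdiff]
  lia

lemma origin_mem {bcor bstar : ℝ} (hb : ∀ k : ℤ, bcor - bstar ≠ 2 * Real.pi * k) :
    siteProj {0} ∈ quarterAlgebra bcor bstar := by
  have h := siteProj_diff_mem (horizontal_strip_mem hb (-1) (neg_one_lt_zero.le))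
    (horizontal_strip_mem hb 0 (neg_one_lt_zero.le))
    fun n hn => ⟨neg_one_lt_zero.trans hn.1, hn.2⟩
  convert h using 2
  ext n
  simp only [Set.mem_ofPred_eq, Set.mem_sdiff, Set.mem_singleton_iff, Prod.ext_iff, Prod.fst_zero,
    Prod.snd_zero]
  lia

lemma rightProj_mem {bcor bstar : ℝ} (hb : ∀ k : ℤ, bcor - bstar ≠ 2 * Real.pi * k) :
    rightProj ∈ quarterAlgebra bcor bstar := by
  have h := horizontal_strip_mem hb (-1) (neg_one_lt_zero.le)
  rw [rightProj]
  convert h using 2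
  ext ⟨a, b⟩
  simp only [Set.mem_ofPred_eq, Set.mem_range, Prod.mk.injEq]
  constructor
  · rintro ⟨j, h1, h2⟩; lia
  · rintro ⟨h1, h2, h3⟩; exact ⟨a.toNat, by lia, by lia⟩

lemma upProj_mem {bcor bstar : ℝ} (hb : ∀ k : ℤ, bcor - bstar ≠ 2 * Real.pi * k) :
    upProj ∈ quarterAlgebra bcor bstar := by
  have h := siteProj_diff_mem (corner_mem hb (-1) (-1)) (corner_mem hb 0 (-1))
    fun n hn => ⟨neg_one_lt_zero.trans hn.1, hn.2⟩
  rw [upProj]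
  convert h using 2
  ext ⟨a, b⟩
  simp only [Set.mem_ofPred_eq, Set.mem_range, Prod.mk.injEq, Set.mem_sdiff]
  constructor
  · rintro ⟨j, h1, h2⟩; lia
  · rintro ⟨⟨h1, h2⟩, h3⟩; exact ⟨b.toNat, by lia, by lia⟩

lemma right_halfPlane_mem {bcor bstar : ℝ} (hb : ∀ k : ℤ, bcor - bstar ≠ 2 * Real.pi * k) :
    siteProj {n | 0 < n.1} ∈ upAlgebra bcor bstar :=
  siteProj_mem_of_field hb _ (fun _ hn => if_neg (not_le.2 hn)) (fun _ hn => if_pos (not_lt.1 hn))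

lemma up_halfPlane_mem {bcor bstar : ℝ} (hb : ∀ k : ℤ, bcor - bstar ≠ 2 * Real.pi * k) :
    siteProj {n | 0 < n.2} ∈ rightAlgebra bcor bstar :=
  siteProj_mem_of_field hb _ (fun _ hn => if_neg (not_le.2 hn)) (fun _ hn => if_pos (not_lt.1 hn))

lemma full_strip_mem {bcor bstar : ℝ} (hb : ∀ k : ℤ, bcor - bstar ≠ 2 * Real.pi * k)
    (N : ℕ) : siteProj (upRegion N ∪ downRegion N)ᶜ ∈ rightAlgebra bcor bstar := by
  have key : ∀ b : ℤ, siteProj {n | b < n.2} ∈ rightAlgebra bcor bstar := fun b => by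
    simpa using siteProj_shift_mem (up_halfPlane_mem hb) (0, b)
  -- The strip is `-N < n₂ ≤ N - 1`. The maximum covers `N = 0`, where the strip is empty and `N - 1
  -- < -N`.
  have h := siteProj_diff_mem (key (-N)) (key (max (-N) (N - 1)))
    fun n (hn : max (-(N : ℤ)) (N - 1) < n.2) => lt_of_le_of_lt (le_max_left _ _) hn
  convert h using 2
  ext n
  simp only [upRegion, downRegion, Set.mem_ofPred_eq, Set.mem_sdiff, Set.mem_compl_iff,
    Set.mem_union]
  lia

/-- The limits to the right and to the left give the two components; the projection onto `n₁ > 0`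
goes to `(1, 0)`, which makes the pair surjective. -/
lemma exists_bulkEvaluation_up {bcor bstar : ℝ} (hb : ∀ k : ℤ, bcor - bstar ≠ 2 * Real.pi * k) :
    ∃ ev : upAlgebra bcor bstar →⋆ₐ[ℂ] BulkAlgebra bcor bstar, IsBulkEvaluation ev := by
  have t1 : IsTransported (constField bcor) rightRegion := isTransported_right fun _ => bcor
  have t2 : IsTransported (constField bstar) leftRegion := isTransported_left fun _ => bstar
  obtain ⟨φ, hφ⟩ := exists_evaluation isRegion_right (agreeOn_up_right bcor bstar) t1
  obtain ⟨ψ, hψ⟩ := exists_evaluation isRegion_left (agreeOn_up_left bcor bstar) t2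
  refine ⟨φ.prod ψ, prod_surjective_of_unit (evaluation_surjective hφ) (evaluation_surjective hψ)
    (x := ⟨_, right_halfPlane_mem hb⟩) ?_ ?_, fun j => Prod.ext (hφ j) (hψ j)⟩
  · refine map_eq_of_vanishesAlong_sub isRegion_right (agreeOn_up_right bcor bstar) t1 hφ
      (vanishesAlong_of_eq_zero 0 fun N _ => ?_)
    change (siteProj {n | 0 < n.1} - 1) * _ = 0
    rw [sub_mul, one_mul, siteProj_mul, Set.inter_eq_right.2, sub_self]
    exact fun n (hn : (N : ℤ) < n.1) => show 0 < n.1 by lia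
  · refine map_eq_zero_of_vanishesAlong isRegion_left (agreeOn_up_left bcor bstar) t2 hψ
      (vanishesAlong_of_eq_zero 0 fun N _ => ?_)
    rw [siteProj_mul, Set.disjoint_iff_inter_eq_empty.1, siteProj_empty]
    exact Set.disjoint_left.2 fun n (h1 : 0 < n.1) (h2 : n.1 ≤ -(N : ℤ)) => by lia

lemma exists_bulkEvaluation_right {bcor bstar : ℝ} (hb : ∀ k : ℤ, bcor - bstar ≠ 2 * Real.pi * k) :
    ∃ ev : rightAlgebra bcor bstar →⋆ₐ[ℂ] BulkAlgebra bcor bstar, IsBulkEvaluation ev := by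
  have t1 : IsTransported (constField bcor) upRegion := isTransported_up fun _ => bcor
  have t2 : IsTransported (constField bstar) downRegion := isTransported_down fun _ => bstar
  obtain ⟨φ, hφ⟩ := exists_evaluation isRegion_up (agreeOn_right_up bcor bstar) t1
  obtain ⟨ψ, hψ⟩ := exists_evaluation isRegion_down (agreeOn_right_down bcor bstar) t2
  refine ⟨φ.prod ψ, prod_surjective_of_unit (evaluation_surjective hφ) (evaluation_surjective hψ)
    (x := ⟨_, up_halfPlane_mem hb⟩) ?_ ?_, fun j => Prod.ext (hφ j) (hψ j)⟩
  · refine map_eq_of_vanishesAlong_sub isRegion_up (agreeOn_right_up bcor bstar) t1 hφ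
      -- `upRegion 0` contains the row `n₂ = 0`, outside the projection; hence the threshold 1.
      (vanishesAlong_of_eq_zero 1 fun N hN => ?_)
    change (siteProj {n | 0 < n.2} - 1) * _ = 0
    rw [sub_mul, one_mul, siteProj_mul, Set.inter_eq_right.2, sub_self]
    exact fun n (hn : (N : ℤ) ≤ n.2) => show 0 < n.2 by lia
  · refine map_eq_zero_of_vanishesAlong isRegion_down (agreeOn_right_down bcor bstar) t2 hψ
      (vanishesAlong_of_eq_zero 0 fun N _ => ?_)
    rw [siteProj_mul, Set.disjoint_iff_inter_eq_empty.1, siteProj_empty]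
    exact Set.disjoint_left.2 fun n (h1 : 0 < n.2) (h2 : n.2 ≤ -(N : ℤ)) => by lia

/-! ### The exact sequence -/

section Exact

variable {bcor bstar : ℝ} {evU : quarterAlgebra bcor bstar →⋆ₐ[ℂ] upAlgebra bcor bstar}
  {evR : quarterAlgebra bcor bstar →⋆ₐ[ℂ] rightAlgebra bcor bstar}
  {evUb : upAlgebra bcor bstar →⋆ₐ[ℂ] BulkAlgebra bcor bstar}
  {evRb : rightAlgebra bcor bstar →⋆ₐ[ℂ] BulkAlgebra bcor bstar}

lemma continuous_bulk_hom {B : Lattice → ℝ} (ev : magAlgebra B →⋆ₐ[ℂ] BulkAlgebra bcor bstar) :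
    Continuous ev :=
  (continuous_magAlgebra_hom ((StarAlgHom.fst ℂ _ _).comp ev)).prodMk
    (continuous_magAlgebra_hom ((StarAlgHom.snd ℂ _ _).comp ev))

lemma bulk_comp_eq (hU : IsEvaluation evU) (hR : IsEvaluation evR) (hUb : IsBulkEvaluation evUb)
    (hRb : IsBulkEvaluation evRb) (a : quarterAlgebra bcor bstar) :
    evUb (evU a) = evRb (evR a) := by
  have h1 : Continuous (evUb.comp evU) := continuous_bulk_hom _
  have h2 : Continuous (evRb.comp evR) := continuous_bulk_hom _
  have h := starAlgHom_eq_of_generators (gen_generates _) h1 h2 fun j => by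
    rw [StarAlgHom.comp_apply, StarAlgHom.comp_apply, hU.2, hR.2, hUb.2, hRb.2]
  exact DFunLike.congr_fun h a

/-- The quarter-plane field looks like `bstar` both far down and far left. The `bstar` component of
`evUb` composed with `evU` describes both asymptotics, so `evU a = 0` controls these half-planes as
well. -/
lemma isCompactOperator_of_evaluations_eq_zero (hU : IsEvaluation evU) (hR : IsEvaluation evR)
    (hUb : IsBulkEvaluation evUb) {a : quarterAlgebra bcor bstar} (h1 : evU a = 0)
    (h2 : evR a = 0) : IsCompactOperator (a : BoundedOp) := by
  let φ : quarterAlgebra bcor bstar →⋆ₐ[ℂ] magAlgebra (constField bstar) :=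
    (StarAlgHom.snd ℂ _ _).comp (evUb.comp evU)
  have hφ : ∀ j, φ (gen _ j) = gen _ j := fun j => by
    change (evUb (evU (gen _ j))).2 = _
    rw [hU.2, hUb.2]
  have hφa : φ a = 0 := by
    change (evUb (evU a)).2 = 0
    rw [h1, map_zero]; rfl
  exact isCompactOperator_of_vanishesAlong
    (vanishesAlong_of_map_eq_zero isRegion_up (agreeOn_quarter_up _ _) hU.2 h1)
    (vanishesAlong_of_map_eq_zero isRegion_down (agreeOn_quarter_down _ _) hφ hφa)
    (vanishesAlong_of_map_eq_zero isRegion_right (agreeOn_quarter_right _ _) hR.2 h2)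
    (vanishesAlong_of_map_eq_zero isRegion_left (agreeOn_quarter_left _ _) hφ hφa)

lemma evU_compact (hU : IsEvaluation evU) {a : quarterAlgebra bcor bstar}
    (ha : IsCompactOperator (a : BoundedOp)) : evU a = 0 :=
  map_eq_zero_of_vanishesAlong isRegion_up (agreeOn_quarter_up _ _) (isTransported_upField _ _) hU.2
    (vanishesAlong_of_isCompactOperator isRegion_up.antitone isRegion_up.exists_notMem ha)

lemma evR_compact (hR : IsEvaluation evR) {a : quarterAlgebra bcor bstar}
    (ha : IsCompactOperator (a : BoundedOp)) : evR a = 0 :=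
  map_eq_zero_of_vanishesAlong isRegion_right (agreeOn_quarter_right _ _)
    (isTransported_rightField _ _) hR.2
    (vanishesAlong_of_isCompactOperator isRegion_right.antitone isRegion_right.exists_notMem ha)

lemma evU_rightProj (hU : IsEvaluation evU) (h : rightProj ∈ quarterAlgebra bcor bstar) :
    evU ⟨rightProj, h⟩ = 0 := by
  refine map_eq_zero_of_vanishesAlong isRegion_up (agreeOn_quarter_up _ _)
    (isTransported_upField _ _) hU.2 (vanishesAlong_of_eq_zero 1 fun N hN => ?_)
  change rightProj * _ = 0
  rw [rightProj, siteProj_mul, Set.disjoint_iff_inter_eq_empty.1, siteProj_empty]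
  refine Set.disjoint_left.2 ?_
  rintro _ ⟨j, rfl⟩ (h2 : (N : ℤ) ≤ 0)
  lia

lemma evR_upProj (hR : IsEvaluation evR) (h : upProj ∈ quarterAlgebra bcor bstar) :
    evR ⟨upProj, h⟩ = 0 := by
  refine map_eq_zero_of_vanishesAlong isRegion_right (agreeOn_quarter_right _ _)
    (isTransported_rightField _ _) hR.2 (vanishesAlong_of_eq_zero 0 fun N hN => ?_)
  change upProj * _ = 0
  rw [upProj, siteProj_mul, Set.disjoint_iff_inter_eq_empty.1, siteProj_empty]
  refine Set.disjoint_left.2 ?_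
  rintro _ ⟨j, rfl⟩ (h2 : (N : ℤ) < 0)
  lia

/-- The projection onto a strip along the horizontal axis lifts to the kernel of `evU`. -/
lemma exists_strip_lift (hb : ∀ k : ℤ, bcor - bstar ≠ 2 * Real.pi * k) (hU : IsEvaluation evU)
    (hR : IsEvaluation evR) (N : ℕ) :
    ∃ p, evU p = 0 ∧ (evR p : BoundedOp) = siteProj (upRegion N ∪ downRegion N)ᶜ := by
  -- The part of the strip in `n₁ > 0`: it has bounded height, so it vanishes upwards, and it
  -- coincides with the full strip on `rightRegion 0`.
  have hp := horizontal_strip_mem hb 0 (le_max_left (-(N : ℤ)) (N - 1))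
  refine ⟨⟨_, hp⟩, ?_, ?_⟩
  · refine map_eq_zero_of_vanishesAlong isRegion_up (agreeOn_quarter_up _ _)
      (isTransported_upField _ _) hU.2 (vanishesAlong_of_eq_zero N fun M hM => ?_)
    rw [siteProj_mul, Set.disjoint_iff_inter_eq_empty.1, siteProj_empty]
    refine Set.disjoint_left.2 ?_
    rintro n ⟨h1, h2, h3⟩ (h4 : (M : ℤ) ≤ n.2)
    lia
  · refine congrArg Subtype.val (map_eq_of_vanishesAlong_sub isRegion_right
      (agreeOn_quarter_right _ _) (isTransported_rightField _ _) hR.2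
      (b := ⟨_, full_strip_mem hb N⟩) (vanishesAlong_of_eq_zero 0 fun M _ => ?_))
    rw [sub_mul, siteProj_mul, siteProj_mul, sub_eq_zero]
    congr 1
    ext n
    simp only [upRegion, downRegion, rightRegion, Set.mem_ofPred_eq, Set.mem_compl_iff,
      Set.mem_union, Set.mem_inter_iff]
    lia

/-- Vanishing upwards and downwards, `r` is the limit of its cut-offs to strips. A preimage of `r`
times the lifted strip `p N` maps to `0` and to this cut-off, and the joint range is closed. -/
lemma exists_lift_of_bulk_eq_zero (hb : ∀ k : ℤ, bcor - bstar ≠ 2 * Real.pi * k)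
    (hU : IsEvaluation evU) (hR : IsEvaluation evR) (hRb : IsBulkEvaluation evRb)
    {r : rightAlgebra bcor bstar} (hr : evRb r = 0) : ∃ c, evU c = 0 ∧ evR c = r := by
  have hup : VanishesAlong upRegion r :=
    vanishesAlong_of_map_eq_zero isRegion_up (agreeOn_right_up _ _)
      (φ := (StarAlgHom.fst ℂ _ _).comp evRb) (fun j => congrArg Prod.fst (hRb.2 j))
      (congrArg Prod.fst hr)
  have hdown : VanishesAlong downRegion r :=
    vanishesAlong_of_map_eq_zero isRegion_down (agreeOn_right_down _ _)
      (φ := (StarAlgHom.snd ℂ _ _).comp evRb) (fun j => congrArg Prod.snd (hRb.2 j))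
      (congrArg Prod.snd hr)
  choose p hpU hpR using exists_strip_lift hb hU hR
  obtain ⟨b, hbr⟩ := hR.1 r
  have ht : Tendsto (fun N => (evU.prod evR) (b * p N)) atTop (𝓝 (0, r)) := by
    have e : ∀ N, (evU.prod evR) (b * p N) = (0, r * evR (p N)) := fun N =>
      Prod.ext (by simp [hpU]) (by simp [hbr])
    simp only [e]
    refine tendsto_const_nhds.prodMk_nhds (tendsto_subtype_rng.2 ?_)
    refine (hup.union hdown).tendsto_compl.congr fun N => ?_
    rw [← hpR]; rfl
  have hcl : IsClosed (Set.range (evU.prod evR)) := by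
    have := isClosed_magAlgebra (quarterField bcor bstar)
    have := isClosed_magAlgebra (upField bcor bstar)
    have := isClosed_magAlgebra (rightField bcor bstar)
    exact isClosed_range_starAlgHom (evU.prod evR)
  obtain ⟨c, hc⟩ := hcl.mem_of_tendsto ht
    (Eventually.of_forall fun N => ⟨_, rfl⟩)
  exact ⟨c, congrArg Prod.fst hc, congrArg Prod.snd hc⟩

/-- After lifting `u` to `a`, the error `r - evR a` has zero bulk part and can be corrected within
the kernel of `evU`. -/
lemma exists_lift_of_bulk_eq (hb : ∀ k : ℤ, bcor - bstar ≠ 2 * Real.pi * k)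
    (hU : IsEvaluation evU) (hR : IsEvaluation evR) (hUb : IsBulkEvaluation evUb)
    (hRb : IsBulkEvaluation evRb) {u : upAlgebra bcor bstar} {r : rightAlgebra bcor bstar}
    (hur : evUb u = evRb r) : ∃ a, evU a = u ∧ evR a = r := by
  obtain ⟨a, rfl⟩ := hU.1 u
  have hr : evRb (r - evR a) = 0 := by
    rw [map_sub, ← hur, bulk_comp_eq hU hR hUb hRb, sub_self]
  obtain ⟨c, hcU, hcR⟩ := exists_lift_of_bulk_eq_zero hb hU hR hRb hr
  exact ⟨a + c, by rw [map_add, hcU, add_zero], by rw [map_add, hcR, add_sub_cancel]⟩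

lemma isCompactOperator_iff_mem_closedIdeal (hb : ∀ k : ℤ, bcor - bstar ≠ 2 * Real.pi * k)
    (hU : IsEvaluation evU) (hR : IsEvaluation evR) (hUb : IsBulkEvaluation evUb)
    (hr : rightProj ∈ quarterAlgebra bcor bstar) (hu : upProj ∈ quarterAlgebra bcor bstar)
    (a : quarterAlgebra bcor bstar) :
    IsCompactOperator (a : BoundedOp) ↔
      a ∈ closedIdeal (⟨rightProj, hr⟩ : quarterAlgebra bcor bstar) ∩
        closedIdeal (⟨upProj, hu⟩ : quarterAlgebra bcor bstar) := by
  have h0 := origin_mem hb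
  constructor
  · refine fun ha => ⟨compact_mem_closedIdeal h0 ?_ ha, compact_mem_closedIdeal h0 ?_ ha⟩
    · change siteProj {0} * rightProj = siteProj {0}
      rw [rightProj, siteProj_mul, Set.inter_eq_left.2]
      exact Set.singleton_subset_iff.2 ⟨0, rfl⟩
    · change siteProj {0} * upProj = siteProj {0}
      rw [upProj, siteProj_mul, Set.inter_eq_left.2]
      exact Set.singleton_subset_iff.2 ⟨0, rfl⟩
  · rintro ⟨h1, h2⟩
    exact isCompactOperator_of_evaluations_eq_zero hU hR hUb
      (map_eq_zero_of_mem_closedIdeal (continuous_magAlgebra_hom evU) (evU_rightProj hU hr) h1)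
      (map_eq_zero_of_mem_closedIdeal (continuous_magAlgebra_hom evR) (evR_upProj hR hu) h2)

end Exact

/-- The inclusion of the compact operators. -/
def compactInclusion {B : Lattice → ℝ} (h : siteProj {0} ∈ magAlgebra B) :
    compactOps →⋆ₙₐ[ℂ] magAlgebra B where
  toFun k := ⟨k, compact_mem_magAlgebra h k.2⟩
  map_smul' _ _ := rfl
  map_zero' := rfl
  map_add' _ _ := rfl
  map_mul' _ _ := rfl
  map_star' _ := rfl

lemma mem_range_compactInclusion {B : Lattice → ℝ} (h : siteProj {0} ∈ magAlgebra B)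
    (a : magAlgebra B) :
    a ∈ Set.range (compactInclusion h) ↔ IsCompactOperator (a : BoundedOp) :=
  ⟨by rintro ⟨k, rfl⟩; exact k.2, fun ha => ⟨⟨a, ha⟩, rfl⟩⟩

lemma compactInclusion_injective {B : Lattice → ℝ} (h : siteProj {0} ∈ magAlgebra B) :
    Function.Injective (compactInclusion h) := fun _ _ hkl =>
  Subtype.ext (congrArg (fun x : magAlgebra B => x.val) hkl)

lemma exists_exact_sequence {bcor bstar : ℝ} (hb : ∀ k : ℤ, bcor - bstar ≠ 2 * Real.pi * k)
    {evU : quarterAlgebra bcor bstar →⋆ₐ[ℂ] upAlgebra bcor bstar}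
    {evR : quarterAlgebra bcor bstar →⋆ₐ[ℂ] rightAlgebra bcor bstar}
    {evUb : upAlgebra bcor bstar →⋆ₐ[ℂ] BulkAlgebra bcor bstar}
    {evRb : rightAlgebra bcor bstar →⋆ₐ[ℂ] BulkAlgebra bcor bstar}
    (hU : IsEvaluation evU) (hR : IsEvaluation evR) (hUb : IsBulkEvaluation evUb)
    (hRb : IsBulkEvaluation evRb) :
    ∃ (i : compactOps →⋆ₙₐ[ℂ] quarterAlgebra bcor bstar)
      (γ : quarterAlgebra bcor bstar →⋆ₐ[ℂ] asymptoticAlgebra evUb evRb),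
      (∀ k, (i k : BoundedOp) = k) ∧
      (∀ a, (γ a : upAlgebra bcor bstar × rightAlgebra bcor bstar) = (evU a, evR a)) ∧
      Function.Injective i ∧ Function.Exact i γ ∧ Function.Surjective γ ∧
      ∃ (hr : rightProj ∈ quarterAlgebra bcor bstar) (hu : upProj ∈ quarterAlgebra bcor bstar),
        Set.range i =
          closedIdeal (⟨rightProj, hr⟩ : quarterAlgebra bcor bstar) ∩
            closedIdeal (⟨upProj, hu⟩ : quarterAlgebra bcor bstar) := by
  have h0 := origin_mem hb
  have hr := rightProj_mem hb
  have hu := upProj_mem hb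
  have hγ : ∀ a, (evU.prod evR) a ∈ asymptoticAlgebra evUb evRb := bulk_comp_eq hU hR hUb hRb
  refine ⟨compactInclusion h0,
    (evU.prod evR).codRestrict _ hγ, fun _ => rfl, fun _ => rfl,
    compactInclusion_injective h0, fun a => ?_, ?_, hr, hu, ?_⟩
  · rw [mem_range_compactInclusion]
    constructor
    · intro h
      have h' : (evU a, evR a) = 0 := congrArg Subtype.val h
      exact isCompactOperator_of_evaluations_eq_zero hU hR hUb (congrArg Prod.fst h')
        (congrArg Prod.snd h')
    · exact fun ha => Subtype.ext (Prod.ext (evU_compact hU ha) (evR_compact hR ha))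
  · rintro ⟨⟨u, r⟩, hur⟩
    exact (exists_lift_of_bulk_eq hb hU hR hUb hRb hur).imp fun a ha =>
      Subtype.ext (Prod.ext ha.1 ha.2)
  · ext a
    rw [mem_range_compactInclusion]
    exact isCompactOperator_iff_mem_closedIdeal hb hU hR hUb hr hu a

lemma exists_evaluation_up (bcor bstar : ℝ) :
    ∃ ev : quarterAlgebra bcor bstar →⋆ₐ[ℂ] upAlgebra bcor bstar, IsEvaluation ev := by
  obtain ⟨ev, h⟩ := exists_evaluation isRegion_up (agreeOn_quarter_up bcor bstar)
    (isTransported_upField bcor bstar)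
  exact ⟨ev, evaluation_surjective h, h⟩

lemma exists_evaluation_right (bcor bstar : ℝ) :
    ∃ ev : quarterAlgebra bcor bstar →⋆ₐ[ℂ] rightAlgebra bcor bstar, IsEvaluation ev := by
  obtain ⟨ev, h⟩ := exists_evaluation isRegion_right (agreeOn_quarter_right bcor bstar)
    (isTransported_rightField bcor bstar)
  exact ⟨ev, evaluation_surjective h, h⟩

end MagneticQuarterPlane

theorem mainTheorem4 (bcor bstar : ℝ) (hb : ∀ k : ℤ, bcor - bstar ≠ 2 * Real.pi * k) :
    ∃ (evU : quarterAlgebra bcor bstar →⋆ₐ[ℂ] upAlgebra bcor bstar)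
      (evR : quarterAlgebra bcor bstar →⋆ₐ[ℂ] rightAlgebra bcor bstar)
      (evUb : upAlgebra bcor bstar →⋆ₐ[ℂ] BulkAlgebra bcor bstar)
      (evRb : rightAlgebra bcor bstar →⋆ₐ[ℂ] BulkAlgebra bcor bstar),
      IsEvaluation evU ∧ IsEvaluation evR ∧ IsBulkEvaluation evUb ∧ IsBulkEvaluation evRb ∧
      ∃ (i : compactOps →⋆ₙₐ[ℂ] quarterAlgebra bcor bstar)
        (γ : quarterAlgebra bcor bstar →⋆ₐ[ℂ] asymptoticAlgebra evUb evRb),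
        (∀ k, (i k : BoundedOp) = k) ∧
        (∀ a, (γ a : upAlgebra bcor bstar × rightAlgebra bcor bstar) = (evU a, evR a)) ∧
        Function.Injective i ∧ Function.Exact i γ ∧ Function.Surjective γ ∧
        ∃ (hr : rightProj ∈ quarterAlgebra bcor bstar) (hu : upProj ∈ quarterAlgebra bcor bstar),
          Set.range i =
            closedIdeal (⟨rightProj, hr⟩ : quarterAlgebra bcor bstar) ∩
              closedIdeal (⟨upProj, hu⟩ : quarterAlgebra bcor bstar) := by
  have hU := (exists_evaluation_up bcor bstar).choose_spec
  have hR := (exists_evaluation_right bcor bstar).choose_spec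
  have hUb := (exists_bulkEvaluation_up hb).choose_spec
  have hRb := (exists_bulkEvaluation_right hb).choose_spec
  exact ⟨_, _, _, _, hU, hR, hUb, hRb, exists_exact_sequence hb hU hR hUb hRb⟩
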